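/- Let $A,B,C\in\mathbb R$ satisfy $(A,B,C)\neq(0,0,0)$, $A\le 0$ and $|B|\le 3A+C$, and put $\mathcal F(y)=3Ay^2+By+C$. Let $H^{-1}((-1,1);\mathbb C)$ be the dual space of $H^1_0((-1,1);\mathbb C)$. Then there is a constant $c>0$ depending only on $A,B,C$ such that for every real $\xi\neq0$ and every $h\in H^{-1}((-1,1);\mathbb C)$ the boundary value problem $$\varphi''''-2\xi^2\varphi''+\xi^4\varphi-i\xi\big[\mathcal F\,(\varphi''-\xi^2\varphi)-6A\varphi\big]=h\ \text{ in } H^{-1}((-1,1);\mathbb C),\qquad \varphi(\pm1)=\varphi'(\pm1)=0,$$ has a unique solution $\varphi\in H^3((-1,1);\mathbb C)\cap H^2_0((-1,1);\mathbb C)$ (the boundary conditions being understood as membership in $H^2_0$), and this solution satisfies $$\int_{-1}^1\big(|\varphi''|^2+2\xi^2|\varphi'|^2+\xi^4|\varphi|^2\big)\,dy\ \le\ c\,\min\big\{\|h\|_{H^{-1}}^2,\ \xi^{-2}\|h\|_{L^2}^2\big\},$$ where $\|h\|_{L^2}=+\infty$ if $h\notin L^2((-1,1);\mathbb C)$. 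-/

import Mathlib

open MeasureTheory Set
open scoped ContDiff

namespace OrrSommerfeld

/-- Lebesgue measure on the open interval `(-1,1)`. -/
noncomputable abbrev μ : Measure ℝ := volume.restrict (Ioo (-1 : ℝ) 1)

/-- The complex Hilbert space `L²((-1,1); ℂ)`. -/
abbrev L2 : Type := Lp ℂ 2 μ

/-- Test functions: `η ∈ C_c^∞((-1,1); ℂ)`. -/
structure IsTest (η : ℝ → ℂ) : Prop where
  contDiff : ContDiff ℝ ∞ η
  hasCompactSupport : HasCompactSupport η
  tsupport_subset : tsupport η ⊆ Ioo (-1 : ℝ) 1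

/-- `v` is the weak derivative of order `j` of `u` on `(-1,1)`. -/
def IsWeakDeriv (j : ℕ) (u v : L2) : Prop :=
  ∀ η : ℝ → ℂ, IsTest η →
    ∫ y, u y * iteratedDeriv j η y ∂μ = (-1 : ℂ) ^ j * ∫ y, v y * η y ∂μ

theorem IsTest.zero : IsTest (fun _ => 0) :=
  ⟨contDiff_const, HasCompactSupport.zero, by
    have : tsupport (fun _ : ℝ => (0 : ℂ)) = ∅ := by
      rw [tsupport_eq_empty_iff]; rfl
    rw [this]; exact empty_subset _⟩

theorem IsTest.add {η θ : ℝ → ℂ} (h : IsTest η) (h' : IsTest θ) : IsTest (η + θ) :=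
  ⟨h.contDiff.add h'.contDiff, h.hasCompactSupport.add h'.hasCompactSupport,
    (tsupport_add η θ).trans (union_subset h.tsupport_subset h'.tsupport_subset)⟩

theorem IsTest.smul {η : ℝ → ℂ} (c : ℂ) (h : IsTest η) : IsTest (c • η) :=
  ⟨contDiff_const.smul h.contDiff, h.hasCompactSupport.smul_left (f := fun _ => c),
    (closure_mono (Function.support_const_smul_subset c η)).trans h.tsupport_subset⟩

theorem integrable_mul_iteratedDeriv (u : L2) {η : ℝ → ℂ} (h : IsTest η) (j : ℕ) :
    Integrable (fun y => u y * iteratedDeriv j η y) μ := by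
  have hc : Continuous (iteratedDeriv j η) :=
    h.contDiff.continuous_iteratedDeriv j (by exact_mod_cast le_top)
  have hs : HasCompactSupport (iteratedDeriv j η) := by
    rw [iteratedDeriv_eq_equiv_comp]
    exact (h.hasCompactSupport.iteratedFDeriv (𝕜 := ℝ) j).comp_left (map_zero _)
  have hm : MemLp (iteratedDeriv j η) 2 μ := (hc.memLp_of_hasCompactSupport hs).restrict _
  exact (Lp.memLp u).integrable_mul hm

theorem IsWeakDeriv.zero (j : ℕ) : IsWeakDeriv j 0 0 := by
  intro η _
  have e : ∀ f : ℝ → ℂ, ∫ y, (0 : L2) y * f y ∂μ = 0 := by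
    intro f
    refine integral_eq_zero_of_ae ?_
    filter_upwards [Lp.coeFn_zero ℂ 2 μ] with y hy
    rw [hy, Pi.zero_apply, zero_mul]
  rw [e, e, mul_zero]

theorem IsWeakDeriv.add {j : ℕ} {u v u' v' : L2} (h : IsWeakDeriv j u v)
    (h' : IsWeakDeriv j u' v') : IsWeakDeriv j (u + u') (v + v') := by
  intro η hη
  have e : ∀ (a b : L2) (i : ℕ), ∫ y, (a + b : L2) y * iteratedDeriv i η y ∂μ =
      ∫ y, a y * iteratedDeriv i η y ∂μ + ∫ y, b y * iteratedDeriv i η y ∂μ := by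
    intro a b i
    rw [← integral_add (integrable_mul_iteratedDeriv a hη i)
      (integrable_mul_iteratedDeriv b hη i)]
    refine integral_congr_ae ?_
    filter_upwards [Lp.coeFn_add a b] with y hy
    rw [hy, Pi.add_apply, add_mul]
  have e0 := e v v' 0
  simp only [iteratedDeriv_zero] at e0
  rw [e, e0, h η hη, h' η hη, mul_add]

theorem IsWeakDeriv.smul {j : ℕ} {u v : L2} (c : ℂ) (h : IsWeakDeriv j u v) :
    IsWeakDeriv j (c • u) (c • v) := by
  intro η hη
  have e : ∀ (a : L2) (i : ℕ), ∫ y, (c • a : L2) y * iteratedDeriv i η y ∂μ =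
      c * ∫ y, a y * iteratedDeriv i η y ∂μ := by
    intro a i
    rw [← integral_const_mul]
    refine integral_congr_ae ?_
    filter_upwards [Lp.coeFn_smul c a] with y hy
    rw [hy, Pi.smul_apply, smul_eq_mul, mul_assoc]
  have e0 := e v 0
  simp only [iteratedDeriv_zero] at e0
  rw [e, e0, h η hη]
  ring

/-- The Sobolev space `H^k((-1,1); ℂ)`, with norm `(∑_{j ≤ k} ‖u^{(j)}‖²_{L²})^{1/2}`. An element
is a function `u ∈ L²` listed together with its weak derivatives of orders up to `k`
(which `u` determines): `u.1 j` is the weak derivative of order `j`, and `u.1 0` is `u` itself. -/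
noncomputable def H (k : ℕ) : Submodule ℂ (PiLp 2 fun _ : Fin (k + 1) => L2) where
  carrier := {u | ∀ j : Fin (k + 1), IsWeakDeriv j (u 0) (u j)}
  zero_mem' j := IsWeakDeriv.zero j
  add_mem' hu hv j := (hu j).add (hv j)
  smul_mem' c _ hu j := (hu j).smul c

/-- The elements of `H^k((-1,1); ℂ)` that belong to `C_c^∞((-1,1); ℂ)`. -/
noncomputable def testSubspace (k : ℕ) : Submodule ℂ (H k) where
  carrier := {u | ∃ η : ℝ → ℂ, IsTest η ∧ u.1 0 =ᵐ[μ] η}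
  zero_mem' := ⟨fun _ => 0, IsTest.zero, Lp.coeFn_zero _ _ _⟩
  add_mem' := by
    rintro u v ⟨η, hη, h⟩ ⟨θ, hθ, h'⟩
    exact ⟨η + θ, hη.add hθ, (Lp.coeFn_add (u.1 0) (v.1 0)).trans (h.add h')⟩
  smul_mem' := by
    rintro c u ⟨η, hη, h⟩
    exact ⟨c • η, hη.smul c, (Lp.coeFn_smul c (u.1 0)).trans (h.const_smul c)⟩

/-- `H^k_0((-1,1); ℂ)`: the closure of `C_c^∞((-1,1); ℂ)` in `H^k((-1,1); ℂ)`. -/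
noncomputable def H0 (k : ℕ) : Submodule ℂ (H k) := (testSubspace k).topologicalClosure

/-- `H⁻¹((-1,1); ℂ)`: the dual space of `H^1_0((-1,1); ℂ)`, with the dual norm. -/
abbrev HNegOne : Type := StrongDual ℂ (H0 1)

/-- `h ∈ H⁻¹` is given by the function `g ∈ L²`: `⟨h, v⟩ = ∫ g v` for every `v ∈ H^1_0`. -/
def IsGivenBy (h : HNegOne) (g : L2) : Prop :=
  ∀ v : H0 1, h v = ∫ y, g y * v.1.1 0 y ∂μ

/-- The velocity profile `𝓕(y) = 3 A y² + B y + C`. -/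
def profile (A B C y : ℝ) : ℝ := 3 * A * y ^ 2 + B * y + C

/-- The standing condition on the coefficients (no flow reversal). -/
def Admissible (A B C : ℝ) : Prop :=
  (A, B, C) ≠ (0, 0, 0) ∧ A ≤ 0 ∧ |B| ≤ 3 * A + C

/-- `φ ∈ H³ ∩ H²₀` solves
`φ'''' - 2ξ²φ'' + ξ⁴φ - iξ[𝓕(φ'' - ξ²φ) - 6Aφ] = h`, an equality in `H⁻¹`, where
`φ'''' ∈ H⁻¹` is the functional `v ↦ -∫ φ''' v'`.
The boundary conditions `φ(±1) = φ'(±1) = 0` are the membership in `H²₀`. -/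
structure IsSolution (A B C ξ : ℝ) (h : HNegOne) (φ : H 3) : Prop where
  mem_H0_two : ∃ ψ ∈ H0 2, ψ.1 0 = φ.1 0
  equation : ∀ v : H0 1,
    -(∫ y, φ.1 3 y * v.1.1 1 y ∂μ)
      + (∫ y, (-2 * (ξ : ℂ) ^ 2 * φ.1 2 y + (ξ : ℂ) ^ 4 * φ.1 0 y
          - Complex.I * ξ * ((profile A B C y : ℂ) * (φ.1 2 y - (ξ : ℂ) ^ 2 * φ.1 0 y)
              - 6 * (A : ℂ) * φ.1 0 y)) * v.1.1 0 y ∂μ) = h v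

/-- `∫_{-1}^{1} (|φ''|² + 2ξ²|φ'|² + ξ⁴|φ|²) dy`. -/
noncomputable def energy (ξ : ℝ) (φ : H 3) : ℝ :=
  ∫ y, (‖φ.1 2 y‖ ^ 2 + 2 * ξ ^ 2 * ‖φ.1 1 y‖ ^ 2 + ξ ^ 4 * ‖φ.1 0 y‖ ^ 2) ∂μ

end OrrSommerfeld

namespace OrrSommerfeld

open Filter Topology ComplexConjugate

/-! The unknown is traded for `w = φ''`. With `J` the antiderivative from `-1` (`anti`), `φ ∈ H²₀`
means `φ = J²w` with `w` orthogonal to affine functions (`exists_mem_H0_two_iff`). Writing `h(v) = ∫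
f v'` and integrating the equation twice gives `w + J²Lw + Jf` affine, where `L` (`lower`) collects
the lower order terms. Projecting off the affine functions leaves `(1 + P J² L P) w = -P J f`. Since
`J` is compact, the Fredholm alternative reduces existence and uniqueness to injectivity.

Injectivity comes from testing the homogeneous equation with the conjugate of `p = φ/𝓕`. Since `𝓕φ''
- 𝓕''φ = (𝓕²p')'`, the terms carrying `iξ` are purely imaginary up to an exact derivative. The real
part of the rest is, again up to an exact derivative, a sum of nonnegative terms, because `𝓕 > 0`
inside the interval and `𝓕'' = 6A ≤ 0`. So the real part of a flux is nonincreasing. Its limits at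
the endpoints are `≤ 0` on the left and `≥ 0` on the right, even where `𝓕` has a simple zero. The
flux therefore vanishes, and so does `p` (`hasDerivAt_flux`, `tendsto_flux_of_eq_zero`,
`eq_zero_of_homogeneous`).

The bound uses two regimes. For `|ξ| ≤ r` the inverse operator depends continuously on `ξ`,
including at `ξ = 0` where the operator is `1`, so it is bounded by compactness
(`exists_bound_bvp`). For `|ξ| ≥ r` testing with the conjugate of `φ` suffices: the only term
without a sign is at most `ξ²‖φ''‖‖φ‖`, which half the energy absorbs (`energy_le_of_large`). -/

/-! ### Conjugation and the bilinear pairing on `L²` -/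

theorem norm_star_L2 (u : L2) : ‖star u‖ = ‖u‖ := by
  rw [Lp.norm_def, Lp.norm_def]
  congr 1
  exact eLpNorm_congr_norm_ae ((Lp.coeFn_star u).mono fun y hy => by simp [hy])

theorem integral_mul_eq_inner (u v : L2) : ∫ y, u y * v y ∂μ = inner ℂ (star u) v := by
  rw [L2.inner_def]
  refine integral_congr_ae ?_
  filter_upwards [Lp.coeFn_star u] with y hy
  simp [hy, mul_comm]

theorem integrable_mul (u v : L2) : Integrable (fun y => u y * v y) μ :=
  (Lp.memLp u).integrable_mul (Lp.memLp v)

/-- The bilinear pairing `(u, v) ↦ ∫ u v` on `L²`. -/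
noncomputable def bil : L2 →L[ℂ] L2 →L[ℂ] ℂ :=
  LinearMap.mkContinuous₂
    (LinearMap.mk₂ ℂ (fun u v : L2 => ∫ y, u y * v y ∂μ)
      (fun u u' v => by
        rw [← integral_add (integrable_mul u v) (integrable_mul u' v)]
        refine integral_congr_ae ?_
        filter_upwards [Lp.coeFn_add u u'] with y hy
        rw [hy, Pi.add_apply, add_mul])
      (fun c u v => by
        rw [smul_eq_mul, ← integral_const_mul]
        refine integral_congr_ae ?_
        filter_upwards [Lp.coeFn_smul c u] with y hy
        rw [hy, Pi.smul_apply, smul_eq_mul, mul_assoc])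
      (fun u v v' => by
        rw [← integral_add (integrable_mul u v) (integrable_mul u v')]
        refine integral_congr_ae ?_
        filter_upwards [Lp.coeFn_add v v'] with y hy
        rw [hy, Pi.add_apply, mul_add])
      (fun c u v => by
        rw [smul_eq_mul, ← integral_const_mul]
        refine integral_congr_ae ?_
        filter_upwards [Lp.coeFn_smul c v] with y hy
        rw [hy, Pi.smul_apply, smul_eq_mul, mul_left_comm]))
    1 fun u v => by
      rw [LinearMap.mk₂_apply, integral_mul_eq_inner, one_mul, ← norm_star_L2 u]
      exact norm_inner_le_norm _ _

theorem bil_apply (u v : L2) : bil u v = ∫ y, u y * v y ∂μ := rfl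

theorem bil_eq_inner (u v : L2) : bil u v = inner ℂ (star u) v := integral_mul_eq_inner u v

theorem norm_bil_le (u v : L2) : ‖bil u v‖ ≤ ‖u‖ * ‖v‖ := by
  rw [bil_eq_inner, ← norm_star_L2 u]
  exact norm_inner_le_norm _ _

theorem bil_comm (u v : L2) : bil u v = bil v u := by
  simp only [bil_apply, mul_comm]

theorem bil_star_self (u : L2) : bil u (star u) = (‖u‖ : ℂ) ^ 2 := by
  rw [bil_comm, bil_eq_inner, star_star, inner_self_eq_norm_sq_to_K]
  rfl

/-- The constant function `1`. -/
noncomputable def one : L2 := Lp.const 2 μ 1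

theorem coeFn_one : one =ᵐ[μ] fun _ => (1 : ℂ) := Lp.coeFn_const ..

theorem bil_one (u : L2) : bil one u = ∫ y, u y ∂μ :=
  integral_congr_ae (coeFn_one.mono fun y hy => by simp [hy])

theorem integrable_L2 (u : L2) : Integrable u μ := (Lp.memLp u).integrable (by norm_num)

/-! ### The antiderivative -/

theorem norm_setIntegral_le (u : L2) {s : Set ℝ} (hs : MeasurableSet s) :
    ‖∫ t in s, u t ∂μ‖ ≤ √(μ.real s) * ‖u‖ := by
  rw [← L2.inner_indicatorConstLp_one (𝕜 := ℂ) hs (measure_ne_top μ s) u]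
  refine (norm_inner_le_norm _ _).trans ?_
  rw [norm_indicatorConstLp (by norm_num) (by norm_num), norm_one, one_mul, Real.sqrt_eq_rpow]
  norm_num

/-- The antiderivative of `u` that vanishes at `-1`, as a function on the line. -/
noncomputable def prim (u : L2) (y : ℝ) : ℂ := ∫ t in Iic y, u t ∂μ

theorem norm_prim_le (u : L2) (y : ℝ) : ‖prim u y‖ ≤ √2 * ‖u‖ := by
  refine (norm_setIntegral_le u measurableSet_Iic).trans ?_
  gcongr
  calc μ.real (Iic y) ≤ μ.real univ := measureReal_mono (subset_univ _)
    _ = 2 := by simp [μ, measureReal_def]; norm_num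

/-- Cauchy–Schwarz on the interval between `x` and `y`. This Hölder modulus, uniform over the unit
ball, is the source of all compactness below. -/
theorem norm_prim_sub_le (u : L2) (x y : ℝ) : ‖prim u y - prim u x‖ ≤ √|y - x| * ‖u‖ := by
  wlog h : x ≤ y generalizing x y
  · rw [norm_sub_rev, abs_sub_comm]
    exact this y x (le_of_not_ge h)
  have e : prim u y - prim u x = ∫ t in Ioc x y, u t ∂μ := by
    rw [prim, prim, ← Iic_sdiff_Iic, setIntegral_sdiff measurableSet_Iic
      (integrable_L2 u).integrableOn (Iic_subset_Iic.2 h)]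
  rw [e]
  refine (norm_setIntegral_le u measurableSet_Ioc).trans ?_
  gcongr
  calc μ.real (Ioc x y) ≤ volume.real (Ioc x y) :=
        ENNReal.toReal_mono (by simp) (Measure.restrict_apply_le _ _)
    _ = |y - x| := by simp [h, abs_of_nonneg]

theorem continuous_prim (u : L2) : Continuous (prim u) := by
  refine continuous_iff_continuousAt.2 fun x => tendsto_iff_norm_sub_tendsto_zero.2 ?_
  refine squeeze_zero (fun _ => norm_nonneg _) (fun y => norm_prim_sub_le u x y) ?_
  have : Continuous fun y : ℝ => √|y - x| * ‖u‖ := by fun_prop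
  simpa using this.tendsto x

theorem prim_add (u v : L2) (y : ℝ) : prim (u + v) y = prim u y + prim v y := by
  rw [prim, prim, prim, ← integral_add (integrable_L2 u).integrableOn (integrable_L2 v).integrableOn]
  exact integral_congr_ae (ae_restrict_of_ae (Lp.coeFn_add u v))

theorem prim_smul (c : ℂ) (u : L2) (y : ℝ) : prim (c • u) y = c * prim u y := by
  rw [prim, prim, ← integral_const_mul]
  exact integral_congr_ae (ae_restrict_of_ae (Lp.coeFn_smul c u))

/-- The antiderivative as a continuous function on `[-1,1]`. -/
noncomputable def primBCF : L2 →L[ℂ] BoundedContinuousFunction (Icc (-1 : ℝ) 1) ℂ :=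
  LinearMap.mkContinuous
    { toFun := fun u => BoundedContinuousFunction.mkOfCompact
        ⟨fun y : Icc (-1 : ℝ) 1 => prim u y, (continuous_prim u).comp continuous_subtype_val⟩
      map_add' := fun u v => by ext y; exact prim_add u v y
      map_smul' := fun c u => by ext y; exact prim_smul c u y }
    √2 fun u => (BoundedContinuousFunction.norm_le (by positivity)).2 fun y => norm_prim_le u y

theorem primBCF_apply (u : L2) (y : Icc (-1 : ℝ) 1) : primBCF u y = prim u y := rfl

theorem memLp_of_continuous {f : ℝ → ℂ} (hf : Continuous f) : MemLp f 2 μ := by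
  obtain ⟨C, hC⟩ := (isCompact_Icc (a := (-1 : ℝ)) (b := 1)).exists_bound_of_continuousOn
    hf.continuousOn
  refine MemLp.of_bound hf.aestronglyMeasurable C ?_
  filter_upwards [ae_restrict_mem measurableSet_Ioo] with y hy using hC y (Ioo_subset_Icc_self hy)

theorem memLp_IccExtend (f : BoundedContinuousFunction (Icc (-1 : ℝ) 1) ℂ) :
    MemLp (IccExtend (by norm_num : (-1 : ℝ) ≤ 1) f) 2 μ :=
  memLp_of_continuous f.continuous.Icc_extend'

/-- The inclusion of `C([-1,1])` in `L²`. -/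
noncomputable def bcfToL2 : BoundedContinuousFunction (Icc (-1 : ℝ) 1) ℂ →L[ℂ] L2 :=
  LinearMap.mkContinuous
    { toFun := fun f => (memLp_IccExtend f).toLp
      map_add' := fun f g => by
        rw [← MemLp.toLp_add]; rfl
      map_smul' := fun c f => by
        rw [← MemLp.toLp_const_smul]; rfl }
    √2 fun f => by
      refine (Lp.norm_le_of_ae_bound (C := ‖f‖) (norm_nonneg f) ?_).trans (le_of_eq ?_)
      · filter_upwards [MemLp.coeFn_toLp (memLp_IccExtend f)] with y hy
        simp only [LinearMap.coe_mk, AddHom.coe_mk]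
        rw [hy]
        exact f.norm_coe_le_norm _
      · congr 1
        have : (measureUnivNNReal μ : ℝ) = 2 := by
          rw [measureUnivNNReal, ENNReal.coe_toNNReal_eq_toReal, Measure.restrict_apply_univ,
            Real.volume_Ioo]
          norm_num
        rw [this, Real.sqrt_eq_rpow]
        norm_num

theorem coeFn_bcfToL2 (f : BoundedContinuousFunction (Icc (-1 : ℝ) 1) ℂ) :
    bcfToL2 f =ᵐ[μ] IccExtend (by norm_num : (-1 : ℝ) ≤ 1) f :=
  MemLp.coeFn_toLp (memLp_IccExtend f)

/-- The antiderivative operator `(anti u)(y) = ∫_{-1}^y u` on `L²`. -/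
noncomputable def anti : L2 →L[ℂ] L2 := bcfToL2 ∘L primBCF

theorem coeFn_anti (u : L2) : anti u =ᵐ[μ] prim u := by
  filter_upwards [coeFn_bcfToL2 (primBCF u), ae_restrict_mem measurableSet_Ioo] with y hy hm
  rw [anti, ContinuousLinearMap.comp_apply, hy, IccExtend_of_mem _ _ (Ioo_subset_Icc_self hm),
    primBCF_apply]

/-- Arzelà–Ascoli: antiderivatives of the unit ball are bounded by `√2` and share the modulus of
continuity `√d`. -/
theorem isCompactOperator_primBCF : IsCompactOperator primBCF := by
  refine (isCompactOperator_iff_image_closedBall_subset_compact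
    (primBCF : L2 →ₗ[ℂ] BoundedContinuousFunction (Icc (-1 : ℝ) 1) ℂ) one_pos).2
    ⟨closure (primBCF '' Metric.closedBall 0 1), ?_, subset_closure⟩
  refine BoundedContinuousFunction.arzela_ascoli (Metric.closedBall 0 √2)
    (isCompact_closedBall _ _) _ ?_ ?_
  · rintro f x ⟨u, hu, rfl⟩
    rw [mem_closedBall_zero_iff] at hu ⊢
    refine (norm_prim_le u x).trans ?_
    exact mul_le_of_le_one_right (by positivity) hu
  · refine Metric.equicontinuous_of_continuity_modulus (fun d => √d) ?_ _ ?_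
    · simpa using Real.continuous_sqrt.tendsto 0
    · rintro x y ⟨f, u, hu, rfl⟩
      rw [mem_closedBall_zero_iff] at hu
      rw [dist_comm, dist_eq_norm]
      refine (norm_prim_sub_le u x y).trans ?_
      rw [dist_comm, Subtype.dist_eq, Real.dist_eq]
      exact mul_le_of_le_one_right (by positivity) hu

theorem isCompactOperator_anti : IsCompactOperator anti :=
  isCompactOperator_primBCF.clm_comp bcfToL2

/-- Integration by parts. -/
theorem bil_anti_add (u v : L2) :
    bil u (anti v) + bil (anti u) v = bil one u * bil one v := by
  -- Fubini: the two pairings are integrals of `u(x) v(y)` over the triangles `y ≤ x` and `x ≤ y`,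
  -- which together fill the square.
  have hI : Integrable (fun p : ℝ × ℝ => u p.1 * v p.2) (μ.prod μ) :=
    (integrable_L2 u).mul_prod (integrable_L2 v)
  have h1 : bil u (anti v) = ∫ x, ∫ y, {p : ℝ × ℝ | p.2 ≤ p.1}.indicator
      (fun p : ℝ × ℝ => u p.1 * v p.2) (x, y) ∂μ ∂μ := by
    rw [bil_apply]
    refine integral_congr_ae ?_
    filter_upwards [coeFn_anti v] with x hx
    rw [hx, prim, ← integral_const_mul, ← integral_indicator measurableSet_Iic]
    refine integral_congr_ae (ae_of_all _ fun y => ?_)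
    by_cases h : y ≤ x <;> simp [indicator, h]
  have hm1 : MeasurableSet {p : ℝ × ℝ | p.2 ≤ p.1} := measurableSet_le measurable_snd measurable_fst
  have hm2 : MeasurableSet {p : ℝ × ℝ | p.1 ≤ p.2} := measurableSet_le measurable_fst measurable_snd
  have h2 : bil (anti u) v = ∫ x, ∫ y, {p : ℝ × ℝ | p.1 ≤ p.2}.indicator
      (fun p : ℝ × ℝ => u p.1 * v p.2) (x, y) ∂μ ∂μ := by
    rw [integral_integral_swap (f := fun x y => {p : ℝ × ℝ | p.1 ≤ p.2}.indicator
      (fun p : ℝ × ℝ => u p.1 * v p.2) (x, y)) (hI.indicator hm2), bil_apply]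
    refine integral_congr_ae ?_
    filter_upwards [coeFn_anti u] with x hx
    rw [hx, prim, ← integral_mul_const, ← integral_indicator measurableSet_Iic]
    refine integral_congr_ae (ae_of_all _ fun y => ?_)
    by_cases h : y ≤ x <;> simp [indicator, h]
  rw [h1, h2, ← integral_add (hI.indicator hm1).integral_prod_left
    (hI.indicator hm2).integral_prod_left, bil_one, bil_one, ← integral_mul_const]
  refine integral_congr_ae ?_
  filter_upwards [(hI.indicator hm1).prod_right_ae, (hI.indicator hm2).prod_right_ae]
    with x hx1 hx2
  rw [← integral_add hx1 hx2, ← integral_const_mul]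
  refine integral_congr_ae ?_
  -- The triangles overlap only on the diagonal, whose slices are null.
  filter_upwards [measure_eq_zero_iff_ae_notMem.1 (measure_singleton (μ := μ) x)] with y hy
  have hne : y ≠ x := hy
  rcases lt_or_gt_of_ne hne with h | h
  · simp [indicator, h.le, h.not_ge]
  · simp [indicator, h.le, h.not_ge]

/-! ### Multiplication by continuous functions -/

theorem memLp_mul {a : ℝ → ℝ} (ha : Continuous a) (u : L2) :
    MemLp (fun y => (a y : ℂ) * u y) 2 μ := by
  obtain ⟨c, hc⟩ := (isCompact_Icc (a := (-1 : ℝ)) (b := 1)).exists_bound_of_continuousOn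
    ha.continuousOn
  refine MemLp.of_le_mul (c := c) (Lp.memLp u)
    ((Complex.continuous_ofReal.comp ha).aestronglyMeasurable.mul (Lp.aestronglyMeasurable u)) ?_
  filter_upwards [ae_restrict_mem measurableSet_Ioo] with y hy
  rw [norm_mul, Complex.norm_real]
  gcongr
  exact hc y (Ioo_subset_Icc_self hy)

/-- Multiplication by a continuous real function. -/
noncomputable def mulOp (a : ℝ → ℝ) (ha : Continuous a) : L2 →L[ℂ] L2 :=
  have hb := (isCompact_Icc (a := (-1 : ℝ)) (b := 1)).exists_bound_of_continuousOn ha.continuousOn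
  LinearMap.mkContinuous
    { toFun := fun u => (memLp_mul ha u).toLp
      map_add' := fun u v => by
        rw [← MemLp.toLp_add]
        refine MemLp.toLp_congr _ _ ?_
        filter_upwards [Lp.coeFn_add u v] with y hy
        rw [hy, Pi.add_apply, mul_add, Pi.add_apply]
      map_smul' := fun c u => by
        rw [← MemLp.toLp_const_smul]
        refine MemLp.toLp_congr _ _ ?_
        filter_upwards [Lp.coeFn_smul c u] with y hy
        simp [hy, mul_left_comm] }
    hb.choose fun u => by
      refine Lp.norm_le_mul_norm_of_ae_le_mul ?_
      filter_upwards [MemLp.coeFn_toLp (memLp_mul ha u), ae_restrict_mem measurableSet_Ioo]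
        with y hy hy'
      simp only [LinearMap.coe_mk, AddHom.coe_mk]
      rw [hy, norm_mul, Complex.norm_real]
      gcongr
      exact hb.choose_spec y (Ioo_subset_Icc_self hy')

theorem coeFn_mulOp (a : ℝ → ℝ) (ha : Continuous a) (u : L2) :
    mulOp a ha u =ᵐ[μ] fun y => (a y : ℂ) * u y := MemLp.coeFn_toLp (memLp_mul ha u)

/-! ### Test functions -/

theorem prim_eq_intervalIntegral {u : L2} {k : ℝ → ℂ} (h : u =ᵐ[μ] k) {y : ℝ}
    (hy : y ∈ Icc (-1 : ℝ) 1) : prim u y = ∫ t in (-1)..y, k t := by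
  rw [prim, integral_congr_ae (ae_restrict_of_ae h), μ, Measure.restrict_restrict measurableSet_Iic,
    intervalIntegral.integral_of_le hy.1, inter_comm]
  rcases hy.2.lt_or_eq with h1 | rfl
  · congr 2
    ext t
    simp only [mem_inter_iff, mem_Ioo, mem_Iic, mem_Ioc]
    constructor
    · rintro ⟨⟨a, _⟩, b⟩; exact ⟨a, b⟩
    · rintro ⟨a, b⟩; exact ⟨⟨a, by linarith⟩, b⟩
  · rw [integral_Ioc_eq_integral_Ioo]
    congr 2
    ext t
    simp only [mem_inter_iff, mem_Ioo, mem_Iic]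
    constructor
    · rintro ⟨a, _⟩; exact a
    · rintro ⟨a, b⟩; exact ⟨⟨a, b⟩, b.le⟩

theorem bil_one_eq_prim (u : L2) : bil one u = prim u 1 := by
  rw [bil_one, prim]
  refine (setIntegral_eq_integral_of_ae_compl_eq_zero ?_).symm
  filter_upwards [ae_restrict_mem measurableSet_Ioo] with y hy h
  exact absurd hy.2.le h

/-- A continuous function as an element of `L²`. -/
noncomputable def ofCont (f : ℝ → ℂ) (hf : Continuous f) : L2 := (memLp_of_continuous hf).toLp

theorem coeFn_ofCont {f : ℝ → ℂ} (hf : Continuous f) : ofCont f hf =ᵐ[μ] f :=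
  MemLp.coeFn_toLp (memLp_of_continuous hf)

theorem bil_ofCont (u : L2) {f : ℝ → ℂ} (hf : Continuous f) :
    bil u (ofCont f hf) = ∫ y, u y * f y ∂μ :=
  integral_congr_ae ((coeFn_ofCont hf).mono fun y hy => by simp [hy])

theorem IsTest.continuous {η : ℝ → ℂ} (h : IsTest η) : Continuous η := h.contDiff.continuous

theorem IsTest.deriv {η : ℝ → ℂ} (h : IsTest η) : IsTest (deriv η) :=
  ⟨(contDiff_infty_iff_deriv.1 h.contDiff).2, h.hasCompactSupport.deriv,
    tsupport_deriv_subset.trans h.tsupport_subset⟩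

theorem IsTest.iteratedDeriv {η : ℝ → ℂ} (h : IsTest η) (j : ℕ) : IsTest (iteratedDeriv j η) := by
  induction j with
  | zero => simpa using h
  | succ j ih => rw [iteratedDeriv_succ]; exact ih.deriv

theorem IsTest.apply_eq_zero {η : ℝ → ℂ} (h : IsTest η) {y : ℝ} (hy : y ∉ Ioo (-1 : ℝ) 1) :
    η y = 0 := image_eq_zero_of_notMem_tsupport fun h' => hy (h.tsupport_subset h')

theorem IsTest.integral_deriv {η : ℝ → ℂ} (h : IsTest η) (y : ℝ) :
    ∫ t in (-1)..y, _root_.deriv η t = η y := by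
  rw [intervalIntegral.integral_deriv_eq_sub
    (fun x _ => (h.contDiff.differentiable (by simp)).differentiableAt)
    (h.deriv.continuous.intervalIntegrable _ _), h.apply_eq_zero (y := -1) (by simp), sub_zero]

theorem IsTest.anti_deriv {η : ℝ → ℂ} (h : IsTest η) :
    anti (ofCont (_root_.deriv η) h.deriv.continuous) = ofCont η h.continuous := by
  refine Lp.ext ?_
  filter_upwards [coeFn_anti (ofCont _ h.deriv.continuous), coeFn_ofCont h.continuous,
    ae_restrict_mem measurableSet_Ioo] with y h1 h2 hy
  rw [h1, h2, prim_eq_intervalIntegral (coeFn_ofCont h.deriv.continuous) (Ioo_subset_Icc_self hy),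
    h.integral_deriv]

theorem IsTest.bil_one_deriv {η : ℝ → ℂ} (h : IsTest η) :
    bil one (ofCont (_root_.deriv η) h.deriv.continuous) = 0 := by
  rw [bil_one_eq_prim, prim_eq_intervalIntegral (coeFn_ofCont h.deriv.continuous) (by norm_num),
    h.integral_deriv, h.apply_eq_zero (by simp)]

/-- The primitive from `-1` vanishes to the left of the support of `θ`, and to the right of it
because `θ` has mean zero. -/
theorem IsTest.exists_deriv_eq {θ : ℝ → ℂ} (h : IsTest θ) (h0 : ∫ y, θ y ∂μ = 0) :
    ∃ η, IsTest η ∧ _root_.deriv η = θ := by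
  have hI : ∀ a b, IntervalIntegrable θ volume a b := fun a b => h.continuous.intervalIntegrable a b
  have hd : ∀ y, HasDerivAt (fun y => ∫ t in (-1)..y, θ t) (θ y) y := fun y =>
    intervalIntegral.integral_hasDerivAt_right (hI _ _)
      (h.continuous.stronglyMeasurableAtFilter _ _) h.continuous.continuousAt
  have hde : _root_.deriv (fun y => ∫ t in (-1)..y, θ t) = θ := funext fun y => (hd y).deriv
  obtain ⟨a, b, ha, hb, hab⟩ : ∃ a b : ℝ, -1 < a ∧ b < 1 ∧ tsupport θ ⊆ Icc a b := by
    rcases (tsupport θ).eq_empty_or_nonempty with he | hne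
    · exact ⟨0, 0, by norm_num, by norm_num, by simp [he]⟩
    · obtain ⟨a, ha⟩ := h.hasCompactSupport.isCompact.exists_isLeast hne
      obtain ⟨b, hb⟩ := h.hasCompactSupport.isCompact.exists_isGreatest hne
      exact ⟨a, b, (h.tsupport_subset ha.1).1, (h.tsupport_subset hb.1).2,
        fun x hx => ⟨ha.2 hx, hb.2 hx⟩⟩
  have hz : ∀ t ∉ Icc a b, θ t = 0 := fun t ht =>
    image_eq_zero_of_notMem_tsupport fun h' => ht (hab h')
  have hs : tsupport (fun y => ∫ t in (-1)..y, θ t) ⊆ Icc a b := by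
    refine closure_minimal (fun y hy => ?_) isClosed_Icc
    by_contra hy'
    refine hy ?_
    rw [mem_Icc, not_and_or, not_le, not_le] at hy'
    rcases hy' with h1 | h1
    · show ∫ t in (-1)..y, θ t = 0
      rw [intervalIntegral.integral_congr_uIoo (g := fun _ => 0), intervalIntegral.integral_zero]
      intro t ht
      refine hz t fun h2 => ?_
      have : t < max (-1) y := ht.2
      have := max_lt ha h1
      linarith [h2.1]
    · show ∫ t in (-1)..y, θ t = 0
      rw [← intervalIntegral.integral_add_adjacent_intervals (hI (-1) 1) (hI 1 y),
        intervalIntegral.integral_of_le (by norm_num), integral_Ioc_eq_integral_Ioo, h0, zero_add,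
        intervalIntegral.integral_congr_uIoo (g := fun _ => 0), intervalIntegral.integral_zero]
      intro t ht
      refine hz t fun h2 => ?_
      have : min 1 y < t := ht.1
      have := lt_min hb h1
      linarith [h2.2]
  refine ⟨_, ⟨contDiff_infty_iff_deriv.2 ⟨fun y => (hd y).differentiableAt, ?_⟩,
    HasCompactSupport.of_support_subset_isCompact isCompact_Icc (subset_closure.trans hs),
    hs.trans (Icc_subset_Ioo ha hb)⟩, hde⟩
  rw [hde]; exact h.contDiff

theorem exists_isTest_integral_eq_one : ∃ ρ : ℝ → ℂ, IsTest ρ ∧ ∫ y, ρ y ∂μ = 1 := by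
  let f : ContDiffBump (0 : ℝ) := ⟨1 / 4, 1 / 2, by norm_num, by norm_num⟩
  have hs : tsupport (fun y => (f.normed volume y : ℂ)) ⊆ Metric.closedBall (0 : ℝ) (1 / 2) := by
    rw [← f.tsupport_normed_eq (μ := volume)]
    exact closure_mono fun y hy => by simpa using hy
  have hs' : Metric.closedBall (0 : ℝ) (1 / 2) ⊆ Ioo (-1) 1 := by
    rw [Real.closedBall_eq_Icc]
    exact Icc_subset_Ioo (by norm_num) (by norm_num)
  refine ⟨fun y => (f.normed volume y : ℂ), ⟨Complex.ofRealCLM.contDiff.comp f.contDiff_normed,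
    HasCompactSupport.of_support_subset_isCompact (isCompact_closedBall _ _)
      (subset_closure.trans hs), hs.trans hs'⟩, ?_⟩
  rw [integral_complex_ofReal, setIntegral_eq_integral_of_forall_compl_eq_zero, f.integral_normed]
  · simp
  · intro y hy
    by_contra h
    exact hy (hs' (hs (subset_closure (by simpa using h))))

/-- The fundamental lemma of the calculus of variations in `L²`. -/
theorem eq_zero_of_forall_isTest {u : L2} (h : ∀ η, IsTest η → ∫ y, u y * η y ∂μ = 0) : u = 0 := by
  refine (Lp.eq_zero_iff_ae_eq_zero).2 ?_
  refine (ae_restrict_iff' measurableSet_Ioo).2 ?_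
  refine isOpen_Ioo.ae_eq_zero_of_integral_contDiff_smul_eq_zero
    (IntegrableOn.locallyIntegrableOn (integrable_L2 u)) ?_
  intro g hg hgc hgs
  have ht : tsupport (fun y => (g y : ℂ)) ⊆ tsupport g :=
    closure_mono fun y hy => by simpa using hy
  have := h (fun y => (g y : ℂ)) ⟨Complex.ofRealCLM.contDiff.comp hg,
    hgc.comp_left (g := fun x : ℝ => (x : ℂ)) (by simp), ht.trans hgs⟩
  rw [← this, ← setIntegral_eq_integral_of_forall_compl_eq_zero (s := Ioo (-1 : ℝ) 1)]
  · exact integral_congr_ae (ae_of_all _ fun y => by simp [mul_comm])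
  · intro y hy
    rw [image_eq_zero_of_notMem_tsupport fun h' => hy (hgs h'), zero_smul]

/-! ### Weak derivatives -/

theorem IsWeakDeriv.unique {j : ℕ} {u v v' : L2} (h : IsWeakDeriv j u v)
    (h' : IsWeakDeriv j u v') : v = v' := by
  refine sub_eq_zero.1 (eq_zero_of_forall_isTest fun η hη => ?_)
  have e := (h η hη).symm.trans (h' η hη)
  have e' := mul_left_cancel₀ (pow_ne_zero j (by norm_num : (-1 : ℂ) ≠ 0)) e
  rw [← bil_ofCont _ hη.continuous, map_sub, sub_apply,
    bil_ofCont, bil_ofCont, e', sub_self]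

theorem isWeakDeriv_zero_self (u : L2) : IsWeakDeriv 0 u u := fun η _ => by simp

theorem isWeakDeriv_one_iff {u v : L2} : IsWeakDeriv 1 u v ↔
    ∀ η : ℝ → ℂ, IsTest η → ∫ y, u y * deriv η y ∂μ = -∫ y, v y * η y ∂μ := by
  simp [IsWeakDeriv, iteratedDeriv_one]

theorem isWeakDeriv_anti (v : L2) : IsWeakDeriv 1 (anti v) v := by
  refine isWeakDeriv_one_iff.2 fun η hη => ?_
  have h := bil_anti_add v (ofCont (deriv η) hη.deriv.continuous)
  rw [hη.anti_deriv, hη.bil_one_deriv, mul_zero, bil_ofCont, bil_ofCont] at h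
  exact eq_neg_of_add_eq_zero_right h

theorem isWeakDeriv_one_zero : IsWeakDeriv 1 one 0 := by
  refine isWeakDeriv_one_iff.2 fun η hη => ?_
  rw [← bil_ofCont _ hη.deriv.continuous, ← bil_ofCont _ hη.continuous, hη.bil_one_deriv]
  simp

/-- Every test function is a derivative of a test function up to a multiple of a fixed one. -/
theorem IsTest.exists_eq_deriv_add {ρ θ : ℝ → ℂ} (hρ : IsTest ρ) (hρ1 : ∫ y, ρ y ∂μ = 1)
    (hθ : IsTest θ) : ∃ η, IsTest η ∧ θ = _root_.deriv η + (∫ y, θ y ∂μ) • ρ := by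
  have hi : ∀ {η : ℝ → ℂ}, IsTest η → Integrable η μ := fun h =>
    (memLp_of_continuous h.continuous).integrable (by norm_num)
  have h0 : ∫ y, (θ + (-∫ y, θ y ∂μ) • ρ) y ∂μ = 0 := by
    rw [integral_add' (hi hθ) ((hi hρ).smul _)]
    simp only [Pi.smul_apply]
    rw [integral_smul, hρ1]
    simp
  obtain ⟨η, hη, he⟩ := (hθ.add (hρ.smul (-∫ y, θ y ∂μ))).exists_deriv_eq h0
  exact ⟨η, hη, by rw [he]; module⟩

/-- The lemma of du Bois-Reymond. -/
theorem IsWeakDeriv.eq_const {u : L2} (h : IsWeakDeriv 1 u 0) : ∃ c : ℂ, u = c • one := by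
  obtain ⟨ρ, hρ, hρ1⟩ := exists_isTest_integral_eq_one
  -- The value is forced: a constant paired with `ρ`, of integral `1`, returns itself.
  refine ⟨∫ y, u y * ρ y ∂μ, sub_eq_zero.1 (eq_zero_of_forall_isTest fun θ hθ => ?_)⟩
  obtain ⟨η, hη, he⟩ := hρ.exists_eq_deriv_add hρ1 hθ
  have h1 := isWeakDeriv_one_iff.1 h η hη
  rw [← bil_ofCont _ hη.continuous, map_zero, zero_apply, neg_zero] at h1
  have h2 : ∫ y, u y * θ y ∂μ = (∫ y, θ y ∂μ) * ∫ y, u y * ρ y ∂μ := by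
    rw [← integral_const_mul, ← add_zero (∫ y, (∫ y, θ y ∂μ) * (u y * ρ y) ∂μ), ← h1,
      ← integral_add]
    · refine integral_congr_ae (ae_of_all _ fun y => ?_)
      have := congrFun he y
      simp only [Pi.add_apply, Pi.smul_apply, smul_eq_mul] at this
      simp only [this]
      ring
    · simpa using (integrable_mul_iteratedDeriv u hρ 0).const_mul _
    · simpa using integrable_mul_iteratedDeriv u hη.deriv 0
  rw [← bil_ofCont _ hθ.continuous, map_sub, map_smul, sub_apply,
    smul_apply, bil_one, bil_ofCont, smul_eq_mul,
    integral_congr_ae (coeFn_ofCont hθ.continuous), mul_comm, h2, sub_self]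

/-- The second order lemma of du Bois-Reymond. -/
theorem IsWeakDeriv.exists_one_of_two {u : L2} (h : IsWeakDeriv 2 u 0) :
    ∃ c : ℂ, IsWeakDeriv 1 u (c • one) := by
  obtain ⟨ρ, hρ, hρ1⟩ := exists_isTest_integral_eq_one
  -- If `u' = c`, testing with `ρ` gives `∫ u ρ' = -c`.
  refine ⟨-∫ y, u y * deriv ρ y ∂μ, isWeakDeriv_one_iff.2 fun θ hθ => ?_⟩
  obtain ⟨η, hη, he⟩ := hρ.exists_eq_deriv_add hρ1 hθ
  have h1 := h η hη
  rw [← bil_ofCont _ hη.continuous, map_zero, zero_apply, mul_zero, iteratedDeriv_succ,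
    iteratedDeriv_one] at h1
  have h3 : deriv θ = deriv (deriv η) + (∫ y, θ y ∂μ) • deriv ρ := by
    have hd : ∀ {η : ℝ → ℂ}, IsTest η → Differentiable ℝ η := fun h =>
      h.contDiff.differentiable (by simp)
    conv_lhs => rw [he]
    ext y
    rw [deriv_add (hd hη.deriv _) ((hd hρ).const_smul _ _), deriv_const_smul _ (hd hρ _)]
    rfl
  rw [← bil_ofCont _ hθ.continuous, map_smul, smul_apply, bil_one,
    integral_congr_ae (coeFn_ofCont hθ.continuous), h3, smul_eq_mul, neg_mul, neg_neg,
    ← integral_mul_const,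
    ← add_zero (∫ y, u y * deriv ρ y * ∫ y, θ y ∂μ ∂μ), ← h1, ← integral_add]
  · refine integral_congr_ae (ae_of_all _ fun y => ?_)
    simp only [Pi.add_apply, Pi.smul_apply, smul_eq_mul]
    ring
  · simpa using (integrable_mul_iteratedDeriv u hρ.deriv 0).mul_const _
  · simpa using integrable_mul_iteratedDeriv u hη.deriv.deriv 0

theorem IsWeakDeriv.sub {j : ℕ} {u v u' v' : L2} (h : IsWeakDeriv j u v)
    (h' : IsWeakDeriv j u' v') : IsWeakDeriv j (u - u') (v - v') := by
  simpa [sub_eq_add_neg] using h.add (h'.smul (-1))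

theorem IsWeakDeriv.eq_anti_add {u v : L2} (h : IsWeakDeriv 1 u v) :
    ∃ c : ℂ, u = anti v + c • one := by
  have h1 := h.sub (isWeakDeriv_anti v)
  rw [sub_self] at h1
  obtain ⟨c, hc⟩ := h1.eq_const
  exact ⟨c, by rw [← hc]; abel⟩

theorem isWeakDeriv_anti_add (v : L2) (c : ℂ) : IsWeakDeriv 1 (anti v + c • one) v := by
  simpa using (isWeakDeriv_anti v).add (isWeakDeriv_one_zero.smul c)

/-- Composition of weak derivatives. -/
theorem IsWeakDeriv.comp {i j : ℕ} {u v w : L2} (h : IsWeakDeriv i u v) (h' : IsWeakDeriv j v w) :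
    IsWeakDeriv (j + i) u w := by
  intro η hη
  have h1 := h _ (hη.iteratedDeriv j)
  rw [h' η hη, ← mul_assoc, ← pow_add, iteratedDeriv_eq_iterate, iteratedDeriv_eq_iterate,
    ← Function.iterate_add_apply, ← iteratedDeriv_eq_iterate, add_comm i] at h1
  exact h1

/-- If `u` has weak derivatives of orders `i` and `j + i`, then the latter is the weak
derivative of order `j` of the former. -/
theorem IsWeakDeriv.of_add {i j : ℕ} {u v w : L2} (h : IsWeakDeriv i u v)
    (h' : IsWeakDeriv (j + i) u w) : IsWeakDeriv j v w := by
  intro η hη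
  have h1 := h _ (hη.iteratedDeriv j)
  have h2 := h' η hη
  rw [iteratedDeriv_eq_iterate, iteratedDeriv_eq_iterate,
    ← Function.iterate_add_apply, ← iteratedDeriv_eq_iterate, add_comm i, h2, add_comm, pow_add,
    mul_assoc] at h1
  rw [iteratedDeriv_eq_iterate]
  exact (mul_left_cancel₀ (pow_ne_zero i (by norm_num : (-1 : ℂ) ≠ 0)) h1).symm

theorem IsTest.isWeakDeriv_one {η : ℝ → ℂ} (h : IsTest η) :
    IsWeakDeriv 1 (ofCont η h.continuous) (ofCont (_root_.deriv η) h.deriv.continuous) := by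
  rw [← h.anti_deriv]; exact isWeakDeriv_anti _

/-! ### The spaces `H^1_0` and `H^2_0` -/

/-- These closed conditions hold for test functions and so pass to the closure; they express the
vanishing of `v` at `-1` and at `1`. -/
theorem H0_one_property {v : H 1} (hv : v ∈ H0 1) :
    v.1 0 = anti (v.1 1) ∧ bil one (v.1 1) = 0 := by
  have c0 : Continuous fun v : H 1 => v.1 0 :=
    (PiLp.continuous_apply 2 (fun _ => L2) 0).comp continuous_subtype_val
  have c1 : Continuous fun v : H 1 => v.1 1 :=
    (PiLp.continuous_apply 2 (fun _ => L2) 1).comp continuous_subtype_val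
  have hc : IsClosed {v : H 1 | v.1 0 = anti (v.1 1) ∧ bil one (v.1 1) = 0} :=
    (isClosed_eq c0 (anti.continuous.comp c1)).inter
      (isClosed_eq ((bil one).continuous.comp c1) continuous_const)
  refine closure_minimal (s := (testSubspace 1 : Set (H 1))) ?_ hc hv
  rintro v ⟨η, hη, h⟩
  have h0 : v.1 0 = ofCont η hη.continuous := Lp.ext (h.trans (coeFn_ofCont hη.continuous).symm)
  have h1 : v.1 1 = ofCont (deriv η) hη.deriv.continuous := by
    have h2 : IsWeakDeriv 1 (v.1 0) (v.1 1) := v.2 1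
    rw [h0] at h2
    exact h2.unique hη.isWeakDeriv_one
  exact ⟨by rw [h0, h1, hη.anti_deriv], by rw [h1, hη.bil_one_deriv]⟩

theorem H0_two_property {v : H 2} (hv : v ∈ H0 2) :
    v.1 0 = anti (v.1 1) ∧ v.1 1 = anti (v.1 2) ∧ bil one (v.1 1) = 0 ∧ bil one (v.1 2) = 0 := by
  have c : ∀ j : Fin 3, Continuous fun v : H 2 => v.1 j := fun j =>
    (PiLp.continuous_apply 2 (fun _ => L2) j).comp continuous_subtype_val
  have hc : IsClosed {v : H 2 | v.1 0 = anti (v.1 1) ∧ v.1 1 = anti (v.1 2) ∧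
      bil one (v.1 1) = 0 ∧ bil one (v.1 2) = 0} :=
    (isClosed_eq (c 0) (anti.continuous.comp (c 1))).inter
      ((isClosed_eq (c 1) (anti.continuous.comp (c 2))).inter
      ((isClosed_eq ((bil one).continuous.comp (c 1)) continuous_const).inter
      (isClosed_eq ((bil one).continuous.comp (c 2)) continuous_const)))
  refine closure_minimal (s := (testSubspace 2 : Set (H 2))) ?_ hc hv
  rintro v ⟨η, hη, h⟩
  have h0 : v.1 0 = ofCont η hη.continuous := Lp.ext (h.trans (coeFn_ofCont hη.continuous).symm)
  have h1 : v.1 1 = ofCont (deriv η) hη.deriv.continuous := by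
    have h2 : IsWeakDeriv 1 (v.1 0) (v.1 1) := v.2 1
    rw [h0] at h2
    exact h2.unique hη.isWeakDeriv_one
  have h2 : v.1 2 = ofCont (deriv (deriv η)) hη.deriv.deriv.continuous := by
    have h2 : IsWeakDeriv 2 (v.1 0) (v.1 2) := v.2 2
    rw [h0] at h2
    exact h2.unique (hη.isWeakDeriv_one.comp hη.deriv.isWeakDeriv_one)
  exact ⟨by rw [h0, h1, hη.anti_deriv], by rw [h1, h2, hη.deriv.anti_deriv],
    by rw [h1, hη.bil_one_deriv], by rw [h2, hη.deriv.bil_one_deriv]⟩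

/-- The span of the affine functions. -/
noncomputable def affine : Submodule ℂ L2 := Submodule.span ℂ {one, anti one}

instance : FiniteDimensional ℂ affine := by
  unfold affine
  exact FiniteDimensional.span_of_finite ℂ (by simp)

theorem star_eq_of_ae {u v : L2} (h : star (u : ℝ → ℂ) =ᵐ[μ] v) : star u = v :=
  Lp.ext ((Lp.coeFn_star u).trans h)

theorem star_add_L2 (u v : L2) : star (u + v) = star u + star v := by
  refine Lp.ext ?_
  filter_upwards [Lp.coeFn_star (u + v), Lp.coeFn_add u v, Lp.coeFn_star u, Lp.coeFn_star v,
    Lp.coeFn_add (star u) (star v)] with y h1 h2 h3 h4 h5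
  rw [h1, h5, Pi.star_apply, h2, Pi.add_apply, Pi.add_apply, h3, h4, star_add]; rfl

theorem star_smul_L2 (c : ℂ) (u : L2) : star (c • u) = star c • star u := by
  refine Lp.ext ?_
  filter_upwards [Lp.coeFn_star (c • u), Lp.coeFn_smul c u, Lp.coeFn_star u,
    Lp.coeFn_smul (star c) (star u)] with y h1 h2 h3 h4
  rw [h1, h4, Pi.star_apply, h2, Pi.smul_apply, Pi.smul_apply, h3, Pi.star_apply, star_smul]

theorem star_one_L2 : star one = one := by
  refine star_eq_of_ae ?_
  filter_upwards [coeFn_one] with y hy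
  simp [hy]

theorem anti_star (u : L2) : anti (star u) = star (anti u) := by
  refine (star_eq_of_ae ?_).symm
  filter_upwards [coeFn_anti u, coeFn_anti (star u)] with y h1 h2
  rw [Pi.star_apply, h1, h2, prim, prim, integral_congr_ae (ae_restrict_of_ae (Lp.coeFn_star u))]
  exact (integral_conj (f := u)).symm

theorem star_anti_one : star (anti one) = anti one := by rw [← anti_star, star_one_L2]

theorem bil_star (u v : L2) : bil (star u) (star v) = star (bil u v) := by
  rw [bil_eq_inner, star_star, bil_comm, bil_eq_inner]
  exact (inner_conj_symm _ _).symm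

/-- For `φ = J²w` the two conditions are `φ'(1) = 0` and `φ(1) = 0`; the conditions at `-1` are
built into `J`. -/
theorem mem_affine_orthogonal {w : L2} :
    w ∈ affineᗮ ↔ bil one w = 0 ∧ bil one (anti w) = 0 := by
  have h1 : inner ℂ one w = bil one w := by rw [bil_eq_inner, star_one_L2]
  have h2 : inner ℂ (anti one) w = bil (anti one) w := by rw [bil_eq_inner, star_anti_one]
  have h3 := bil_anti_add one w
  rw [affine, Submodule.mem_orthogonal]
  constructor
  · intro h
    have e1 : bil one w = 0 := h1 ▸ h one (Submodule.subset_span (by simp))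
    have e2 : bil (anti one) w = 0 := h2 ▸ h (anti one) (Submodule.subset_span (by simp))
    exact ⟨e1, by simpa [e1, e2] using h3⟩
  · rintro ⟨e1, e2⟩ u hu
    obtain ⟨a, b, rfl⟩ := Submodule.mem_span_pair.1 hu
    have e3 : bil (anti one) w = 0 := by simpa [e1, e2] using h3
    simp [inner_add_left, inner_smul_left, h1, h2, e1, e3]

/-- `w ↦ (∬w, ∫w, w)` as a map from `L²` to `H²`. -/
noncomputable def liftTwo : L2 →L[ℂ] H 2 :=
  (((PiLp.continuousLinearEquiv 2 ℂ fun _ : Fin 3 => L2).symm : _ →L[ℂ] _) ∘L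
    ContinuousLinearMap.pi ![anti ∘L anti, anti, ContinuousLinearMap.id ℂ L2]).codRestrict (H 2)
    fun w j => by
      have h1 : IsWeakDeriv 1 (anti (anti w)) (anti w) := isWeakDeriv_anti _
      fin_cases j
      · exact isWeakDeriv_zero_self _
      · exact h1
      · exact h1.comp (isWeakDeriv_anti w)

theorem liftTwo_zero (w : L2) : (liftTwo w).1 0 = anti (anti w) := rfl

/-- `w ↦ (∫w, w)` as a map from `L²` to `H¹`. -/
noncomputable def liftOne : L2 →L[ℂ] H 1 :=
  (((PiLp.continuousLinearEquiv 2 ℂ fun _ : Fin 2 => L2).symm : _ →L[ℂ] _) ∘L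
    ContinuousLinearMap.pi ![anti, ContinuousLinearMap.id ℂ L2]).codRestrict (H 1)
    fun w j => by
      fin_cases j
      · exact isWeakDeriv_zero_self _
      · exact isWeakDeriv_anti w

theorem liftOne_zero (w : L2) : (liftOne w).1 0 = anti w := rfl

/-- A subspace is dense in the orthogonal complement of `S` if its orthogonal complement
lies in `S`. -/
theorem orthogonal_le_topologicalClosure {S D : Submodule ℂ L2} [S.HasOrthogonalProjection]
    (h : Dᗮ ≤ S) : Sᗮ ≤ D.topologicalClosure := by
  rw [← Submodule.orthogonal_orthogonal_eq_closure]
  exact Submodule.orthogonal_le h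

/-- By duality, second derivatives of test functions are dense in `affineᗮ`: if `z` is orthogonal to
all of them, its conjugate has zero weak second derivative, so `z` is affine. Continuity of
`liftTwo` carries the density over to `H²`. -/
theorem liftTwo_mem_H0 {w : L2} (hw : w ∈ affineᗮ) : liftTwo w ∈ H0 2 := by
  let D : Submodule ℂ L2 := (testSubspace 2).comap (liftTwo : L2 →ₗ[ℂ] H 2)
  have hle : Dᗮ ≤ affine := by
    intro z hz
    have h2 : IsWeakDeriv 2 (star z) 0 := by
      intro η hη
      have hD : ofCont (deriv (deriv η)) hη.deriv.deriv.continuous ∈ D :=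
        ⟨η, hη, by
          rw [ContinuousLinearMap.coe_coe, liftTwo_zero, hη.deriv.anti_deriv, hη.anti_deriv]
          exact coeFn_ofCont _⟩
      have h1 := Submodule.inner_left_of_mem_orthogonal hD hz
      rw [← star_star z, ← bil_eq_inner, bil_ofCont] at h1
      rw [iteratedDeriv_succ, iteratedDeriv_one, h1, ← bil_ofCont _ hη.continuous]
      simp
    obtain ⟨c, hc⟩ := h2.exists_one_of_two
    obtain ⟨d, hd⟩ := hc.eq_anti_add
    rw [← star_star z, hd, map_smul, star_add_L2, star_smul_L2, star_smul_L2, star_anti_one,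
      star_one_L2]
    exact add_mem (Submodule.smul_mem _ _ (Submodule.subset_span (by simp)))
      (Submodule.smul_mem _ _ (Submodule.subset_span (by simp)))
  exact map_mem_closure liftTwo.continuous (orthogonal_le_topologicalClosure hle hw)
    fun u hu => hu

theorem liftOne_mem_H0 {w : L2} (hw : bil one w = 0) : liftOne w ∈ H0 1 := by
  let D : Submodule ℂ L2 := (testSubspace 1).comap (liftOne : L2 →ₗ[ℂ] H 1)
  have hle : Dᗮ ≤ ℂ ∙ one := by
    intro z hz
    have h2 : IsWeakDeriv 1 (star z) 0 := by
      refine isWeakDeriv_one_iff.2 fun η hη => ?_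
      have hD : ofCont (deriv η) hη.deriv.continuous ∈ D :=
        ⟨η, hη, by
          rw [ContinuousLinearMap.coe_coe, liftOne_zero, hη.anti_deriv]
          exact coeFn_ofCont _⟩
      have h1 := Submodule.inner_left_of_mem_orthogonal hD hz
      rw [← star_star z, ← bil_eq_inner, bil_ofCont] at h1
      rw [h1, ← bil_ofCont _ hη.continuous]
      simp
    obtain ⟨c, hc⟩ := h2.eq_const
    rw [← star_star z, hc, star_smul_L2, star_one_L2]
    exact Submodule.smul_mem _ _ (Submodule.mem_span_singleton_self _)
  have hw' : w ∈ (ℂ ∙ one)ᗮ := by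
    rw [Submodule.mem_orthogonal_singleton_iff_inner_right, ← star_one_L2, ← bil_eq_inner, hw]
  exact map_mem_closure liftOne.continuous (orthogonal_le_topologicalClosure hle hw')
    fun u hu => hu

/-! ### The profile -/

theorem hasDerivAt_profile (A B C y : ℝ) : HasDerivAt (profile A B C) (6 * A * y + B) y := by
  have h : HasDerivAt (fun y : ℝ => 3 * A * y ^ 2 + B * y + C) (3 * A * (2 * y) + B * 1) y := by
    simpa using ((((hasDerivAt_pow 2 y).const_mul (3 * A)).add
      ((hasDerivAt_id y).const_mul B)).add_const C)
  exact h.congr_deriv (by ring)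

theorem continuous_profile (A B C : ℝ) : Continuous (profile A B C) := by
  unfold profile
  fun_prop

theorem Admissible.profile_pos {A B C : ℝ} (h : Admissible A B C) {y : ℝ}
    (hy : y ∈ Ioo (-1 : ℝ) 1) : 0 < profile A B C y := by
  obtain ⟨h0, hA, hB⟩ := h
  obtain ⟨hB1, hB2⟩ := abs_le.1 hB
  obtain ⟨hy1, hy2⟩ := hy
  -- The interpolation of the endpoint values plus a concave remainder: three nonnegative terms,
  -- which vanish together only if `A = B = C = 0`.
  have e : profile A B C y = (1 + y) / 2 * (3 * A + B + C) + (1 - y) / 2 * (3 * A - B + C)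
      + 3 * (-A) * ((1 - y) * (1 + y)) := by unfold profile; ring
  have p1 : 0 < 1 + y := by linarith
  have p2 : 0 < 1 - y := by linarith
  have q1 : 0 ≤ 3 * A + B + C := by linarith
  have q2 : 0 ≤ 3 * A - B + C := by linarith
  have q3 : 0 ≤ -A := by linarith
  rw [e]
  rcases q3.lt_or_eq with h3 | h3
  · positivity
  rcases q1.lt_or_eq with h1 | h1
  · positivity
  rcases q2.lt_or_eq with h2 | h2
  · positivity
  refine absurd ?_ h0
  have a : A = 0 := by linarith
  have b : B = 0 := by linarith
  have c : C = 0 := by linarith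
  rw [a, b, c]

theorem Admissible.const_pos {A B C : ℝ} (h : Admissible A B C) : 0 < C := by
  simpa [profile] using h.profile_pos (y := 0) (by norm_num)

/-! ### Uniqueness for the homogeneous problem -/

/-- A function with `f(a) = f'(a) = 0` has a second order expansion at `a`. -/
theorem tendsto_div_sq {f0 f1 f2 : ℝ → ℂ} {a : ℝ} (h0 : ∀ y, HasDerivAt f0 (f1 y) y)
    (h1 : HasDerivAt f1 (f2 a) a) (e0 : f0 a = 0) (e1 : f1 a = 0) :
    Tendsto (fun y => f0 y / ((y - a : ℝ) : ℂ) ^ 2) (𝓝[≠] a) (𝓝 (f2 a / 2)) := by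
  rw [Metric.tendsto_nhdsWithin_nhds]
  intro ε hε
  have h2 := h1.isLittleO
  simp only [e1, sub_zero] at h2
  obtain ⟨δ, hδ, hb⟩ := Metric.eventually_nhds_iff.1 (h2.def (half_pos hε))
  refine ⟨δ, hδ, fun {y} hy hya => ?_⟩
  have hne : y - a ≠ 0 := sub_ne_zero.2 hy
  -- The mean value inequality is applied to `f0` minus its quadratic Taylor term, whose derivative
  -- is `o(x - a)`.
  have hd : ∀ x, HasDerivAt (fun x : ℝ => f0 x - f2 a / 2 * ((x - a : ℝ) : ℂ) ^ 2)
      (f1 x - (x - a) • f2 a) x := by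
    intro x
    have h3 : HasDerivAt (fun x : ℝ => ((x - a : ℝ) : ℂ)) 1 x := by
      simpa using (((hasDerivAt_id x).sub_const a).ofReal_comp)
    refine ((h0 x).sub ((h3.pow 2).const_mul (f2 a / 2))).congr_deriv ?_
    rw [Complex.real_smul]
    simp only [pow_one, Nat.cast_ofNat, mul_one, Nat.add_one_sub_one]
    ring
  have hm := (convex_segment a y).norm_image_sub_le_of_norm_hasDerivWithin_le
    (f := fun x : ℝ => f0 x - f2 a / 2 * ((x - a : ℝ) : ℂ) ^ 2)
    (C := ε / 2 * |y - a|) (fun x _ => (hd x).hasDerivWithinAt) (fun x hx => ?_)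
    (left_mem_segment ℝ a y) (right_mem_segment ℝ a y)
  · simp only [e0, sub_self, Complex.ofReal_zero, ne_eq, OfNat.ofNat_ne_zero, not_false_eq_true,
      zero_pow, mul_zero, sub_zero] at hm
    have h4 : f0 y / ((y - a : ℝ) : ℂ) ^ 2 - f2 a / 2
        = (f0 y - f2 a / 2 * ((y - a : ℝ) : ℂ) ^ 2) / ((y - a : ℝ) : ℂ) ^ 2 := by
      have : ((y - a : ℝ) : ℂ) ≠ 0 := by exact_mod_cast hne
      field_simp
    rw [dist_eq_norm, h4, norm_div, norm_pow, Complex.norm_real, Real.norm_eq_abs,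
      div_lt_iff₀ (by positivity)]
    rw [Real.norm_eq_abs] at hm
    have : 0 < |y - a| ^ 2 := by positivity
    nlinarith
  · have hx' : |x - a| ≤ |y - a| := by
      rw [segment_eq_uIcc] at hx
      rw [abs_sub_comm x, abs_sub_comm y]
      exact abs_sub_left_of_mem_uIcc hx |> fun h => by simpa [abs_sub_comm] using h
    refine (hb (y := x) ?_).trans ?_
    · rw [Real.dist_eq] at hya ⊢
      exact hx'.trans_lt hya
    · rw [Real.norm_eq_abs]
      gcongr

/-! ### The flux identity for `φ / 𝓕` -/

section
variable (A B C ξ : ℝ) (f0 f1 f2 f3 : ℝ → ℂ)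

/-- The quotient `φ / 𝓕`. -/
noncomputable def quot0 (y : ℝ) : ℂ := f0 y / profile A B C y

/-- The derivative of `φ / 𝓕`. -/
noncomputable def quot1 (y : ℝ) : ℂ :=
  (f1 y - (6 * A * y + B : ℝ) * quot0 A B C f0 y) / profile A B C y

/-- The second derivative of `φ / 𝓕`. -/
noncomputable def quot2 (y : ℝ) : ℂ :=
  (f2 y - (6 * A : ℝ) * quot0 A B C f0 y - 2 * (6 * A * y + B : ℝ) * quot1 A B C f0 f1 y) /
    profile A B C y

/-- The flux whose real part is monotone along solutions. -/
noncomputable def flux (y : ℝ) : ℂ :=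
  f3 y * conj (quot0 A B C f0 y) - f2 y * conj (quot1 A B C f0 f1 y)
    + (6 * A * y + B : ℝ) * (quot1 A B C f0 f1 y * conj (quot1 A B C f0 f1 y))
    + (6 * A : ℝ) * (quot0 A B C f0 y * conj (quot1 A B C f0 f1 y))
    - (2 * ξ ^ 2 : ℝ) * (f1 y * conj (quot0 A B C f0 y))
    + (ξ ^ 2 : ℝ) * ((6 * A * y + B : ℝ) * (quot0 A B C f0 y * conj (quot0 A B C f0 y)))
    - Complex.I * ξ * ((profile A B C y : ℂ) ^ 2 *
        (quot1 A B C f0 f1 y * conj (quot0 A B C f0 y)))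

/-- The dissipation: minus the derivative of the real part of the flux. -/
noncomputable def dissip (y : ℝ) : ℝ :=
  profile A B C y * ‖quot2 A B C f0 f1 f2 y‖ ^ 2
    + 2 * (-(6 * A)) * ‖quot1 A B C f0 f1 y‖ ^ 2
    + 2 * ξ ^ 2 * (profile A B C y * ‖quot1 A B C f0 f1 y‖ ^ 2)
    + ξ ^ 2 * (-(6 * A)) * ‖quot0 A B C f0 y‖ ^ 2
    + ξ ^ 4 * (profile A B C y * ‖quot0 A B C f0 y‖ ^ 2)

variable {A B C ξ f0 f1 f2 f3}

theorem hasDerivAt_quot0 {y : ℝ} (hF : profile A B C y ≠ 0) (h0 : HasDerivAt f0 (f1 y) y) :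
    HasDerivAt (quot0 A B C f0) (quot1 A B C f0 f1 y) y := by
  have hF' : (profile A B C y : ℂ) ≠ 0 := by exact_mod_cast hF
  refine (h0.div (hasDerivAt_profile A B C y).ofReal_comp hF').congr_deriv ?_
  rw [quot1, quot0]
  field_simp

theorem hasDerivAt_quot1 {y : ℝ} (hF : profile A B C y ≠ 0) (h0 : HasDerivAt f0 (f1 y) y)
    (h1 : HasDerivAt f1 (f2 y) y) :
    HasDerivAt (quot1 A B C f0 f1) (quot2 A B C f0 f1 f2 y) y := by
  have hF' : (profile A B C y : ℂ) ≠ 0 := by exact_mod_cast hF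
  have hd : HasDerivAt (fun y : ℝ => ((6 * A * y + B : ℝ) : ℂ)) ((6 * A : ℝ) : ℂ) y := by
    simpa using (((hasDerivAt_id y).const_mul (6 * A)).add_const B).ofReal_comp
  refine ((h1.sub (hd.mul (hasDerivAt_quot0 hF h0))).div
    (hasDerivAt_profile A B C y).ofReal_comp hF').congr_deriv ?_
  simp only [Pi.sub_apply, Pi.mul_apply]
  rw [quot2, quot1]
  field_simp
  ring

/-- With `p = φ/𝓕`, this is the equation times `conj p`, integrated by parts. From `φ'' conj p''`
come `𝓕|p''|²`, the real part of `2𝓕' p' conj p''`, which is `𝓕'(|p'|²)'`, and `𝓕'' p conj p''`; the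
last two yield `-2𝓕''|p'|²` after moving a derivative, `𝓕''` being constant. What `iξ` multiplies is
`(𝓕²p')' conj p - ξ²𝓕²|p|²`, real up to an exact derivative. -/
theorem hasDerivAt_flux {y : ℝ} {f4 : ℂ} (hF : profile A B C y ≠ 0) (h0 : HasDerivAt f0 (f1 y) y)
    (h1 : HasDerivAt f1 (f2 y) y) (h2 : HasDerivAt f2 (f3 y) y) (h3 : HasDerivAt f3 f4 y)
    (h4 : f4 = -(-2 * (ξ : ℂ) ^ 2 * f2 y + (ξ : ℂ) ^ 4 * f0 y
          - Complex.I * ξ * ((profile A B C y : ℂ) * (f2 y - (ξ : ℂ) ^ 2 * f0 y)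
              - 6 * (A : ℂ) * f0 y))) :
    HasDerivAt (fun y => (flux A B C ξ f0 f1 f2 f3 y).re) (-dissip A B C ξ f0 f1 f2 y) y := by
  have hF' : (profile A B C y : ℂ) ≠ 0 := by exact_mod_cast hF
  have hd : HasDerivAt (fun y : ℝ => ((6 * A * y + B : ℝ) : ℂ)) ((6 * A : ℝ) : ℂ) y := by
    simpa using (((hasDerivAt_id y).const_mul (6 * A)).add_const B).ofReal_comp
  have hP := (hasDerivAt_profile A B C y).ofReal_comp
  have q0 := hasDerivAt_quot0 hF h0
  have q1 := hasDerivAt_quot1 hF h0 h1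
  have c0 : HasDerivAt (fun y => conj (quot0 A B C f0 y)) (conj (quot1 A B C f0 f1 y)) y := q0.star
  have c1 : HasDerivAt (fun y => conj (quot1 A B C f0 f1 y)) (conj (quot2 A B C f0 f1 f2 y)) y :=
    q1.star
  have e0 : f0 y = profile A B C y * quot0 A B C f0 y := by rw [quot0]; field_simp
  have e1 : f1 y = profile A B C y * quot1 A B C f0 f1 y
      + (6 * A * y + B : ℝ) * quot0 A B C f0 y := by rw [quot1]; field_simp; ring
  have e2 : f2 y = profile A B C y * quot2 A B C f0 f1 f2 y
      + 2 * (6 * A * y + B : ℝ) * quot1 A B C f0 f1 y + (6 * A : ℝ) * quot0 A B C f0 y := by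
    rw [quot2]; field_simp; ring
  have key := (((((((h3.mul c0).sub (h2.mul c1)).add (hd.mul (q1.mul c1))).add
    ((q0.mul c1).const_mul ((6 * A : ℝ) : ℂ))).sub
    ((h1.mul c0).const_mul ((2 * ξ ^ 2 : ℝ) : ℂ))).add
    ((hd.mul (q0.mul c0)).const_mul ((ξ ^ 2 : ℝ) : ℂ))).sub
    (((hP.pow 2).mul (q1.mul c0)).const_mul (Complex.I * ξ)))
  have key' := Complex.reCLM.hasFDerivAt.comp_hasDerivAt y key
  refine key'.congr_deriv ?_
  rw [dissip, ← Complex.normSq_eq_norm_sq, ← Complex.normSq_eq_norm_sq,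
    ← Complex.normSq_eq_norm_sq, h4]
  simp only [Complex.reCLM_apply, Pi.mul_apply, Pi.pow_apply]
  rw [e2, e1, e0]
  generalize quot2 A B C f0 f1 f2 y = p2
  generalize quot1 A B C f0 f1 y = p1
  generalize quot0 A B C f0 y = p0
  generalize f3 y = g3
  generalize 6 * A * y + B = D
  generalize profile A B C y = P
  simp [Complex.normSq_apply, pow_succ]
  ring

end

/-! ### Endpoint limits of the flux and uniqueness -/

section
variable {A B C ξ : ℝ} {f0 f1 f2 f3 f4 : ℝ → ℂ} {a : ℝ}

theorem tendsto_flux {l : Filter ℝ} (hl : l ≤ 𝓝 a) {L : ℂ} (c1 : ContinuousAt f1 a)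
    (c2 : ContinuousAt f2 a) (c3 : ContinuousAt f3 a)
    (t0 : Tendsto (quot0 A B C f0) l (𝓝 0)) (t1 : Tendsto (quot1 A B C f0 f1) l (𝓝 L)) :
    Tendsto (flux A B C ξ f0 f1 f2 f3) l
      (𝓝 (-(f2 a * conj L) + (6 * A * a + B : ℝ) * (L * conj L))) := by
  have s0 : Tendsto (fun y => conj (quot0 A B C f0 y)) l (𝓝 (conj 0)) :=
    (Complex.continuous_conj.tendsto _).comp t0
  have s1 : Tendsto (fun y => conj (quot1 A B C f0 f1 y)) l (𝓝 (conj L)) :=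
    (Complex.continuous_conj.tendsto _).comp t1
  have hD : Tendsto (fun y : ℝ => ((6 * A * y + B : ℝ) : ℂ)) l (𝓝 ((6 * A * a + B : ℝ) : ℂ)) := by
    have : Continuous fun y : ℝ => ((6 * A * y + B : ℝ) : ℂ) := by fun_prop
    exact (this.tendsto a).mono_left hl
  have hP : Tendsto (fun y : ℝ => (profile A B C y : ℂ)) l (𝓝 (profile A B C a : ℂ)) :=
    ((Complex.continuous_ofReal.comp (continuous_profile A B C)).tendsto a).mono_left hl
  have h1 := c1.tendsto.mono_left hl
  have h2 := c2.tendsto.mono_left hl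
  have h3 := c3.tendsto.mono_left hl
  have key := (((((((h3.mul s0).sub (h2.mul s1)).add (hD.mul (t1.mul s1))).add
    ((t0.mul s1).const_mul ((6 * A : ℝ) : ℂ))).sub
    ((h1.mul s0).const_mul ((2 * ξ ^ 2 : ℝ) : ℂ))).add
    ((hD.mul (t0.mul s0)).const_mul ((ξ ^ 2 : ℝ) : ℂ))).sub
    (((hP.pow 2).mul (t1.mul s0)).const_mul (Complex.I * ξ)))
  refine key.trans (le_of_eq ?_)
  simp

theorem tendsto_flux_of_ne_zero (h0 : ∀ y, HasDerivAt f0 (f1 y) y)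
    (h1 : ∀ y, HasDerivAt f1 (f2 y) y) (h2 : ∀ y, HasDerivAt f2 (f3 y) y)
    (h3 : ContinuousAt f3 a) (e0 : f0 a = 0) (e1 : f1 a = 0) (hF : profile A B C a ≠ 0) :
    Tendsto (fun y => (flux A B C ξ f0 f1 f2 f3 y).re) (𝓝[≠] a) (𝓝 0) := by
  have t0 := (hasDerivAt_quot0 hF (h0 a)).continuousAt.tendsto
  have t1 := (hasDerivAt_quot1 hF (h0 a) (h1 a)).continuousAt.tendsto
  have q0 : quot0 A B C f0 a = 0 := by simp [quot0, e0]
  have q1 : quot1 A B C f0 f1 a = 0 := by simp [quot1, q0, e1]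
  rw [q0] at t0
  rw [q1] at t1
  have := (Complex.continuous_re.tendsto _).comp ((tendsto_flux (ξ := ξ) le_rfl
    (h1 a).continuousAt (h2 a).continuousAt h3 t0 t1).mono_left (nhdsWithin_le_nhds (s := {a}ᶜ)))
  simpa [Function.comp_def] using this

/-- At a simple zero of `𝓕` the double zero of `φ` wins: `p → 0` and `p' → φ''(a)/(2D)` with `D =
𝓕'(a)`. Two flux terms survive, `-|φ''(a)|²/(2D)` and `|φ''(a)|²/(4D)`, so the limit has the sign
opposite to `D`. -/
theorem tendsto_flux_of_eq_zero (h0 : ∀ y, HasDerivAt f0 (f1 y) y)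
    (h1 : ∀ y, HasDerivAt f1 (f2 y) y) (h2 : ∀ y, HasDerivAt f2 (f3 y) y)
    (h3 : ContinuousAt f3 a) (e0 : f0 a = 0) (e1 : f1 a = 0) (hF : profile A B C a = 0)
    (hD : 6 * A * a + B ≠ 0) :
    Tendsto (fun y => (flux A B C ξ f0 f1 f2 f3 y).re) (𝓝[≠] a)
      (𝓝 (-(‖f2 a‖ ^ 2 / (4 * (6 * A * a + B))))) := by
  set D := 6 * A * a + B with hDdef
  have hDc : (D : ℂ) ≠ 0 := by exact_mod_cast hD
  have hlin : Tendsto (fun y : ℝ => ((y - a : ℝ) : ℂ)) (𝓝[≠] a) (𝓝 0) := by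
    have : Continuous fun y : ℝ => ((y - a : ℝ) : ℂ) := by fun_prop
    simpa using (this.tendsto a).mono_left nhdsWithin_le_nhds
  have s0 := tendsto_div_sq h0 (h1 a) e0 e1
  have s1 : Tendsto (fun y => f1 y / ((y - a : ℝ) : ℂ)) (𝓝[≠] a) (𝓝 (f2 a)) := by
    have := hasDerivAt_iff_tendsto_slope.1 (h1 a)
    refine this.congr fun y => ?_
    rw [slope, vsub_eq_sub, e1, sub_zero, Complex.real_smul, Complex.ofReal_inv, div_eq_inv_mul]
  have sF : Tendsto (fun y => (profile A B C y : ℂ) / ((y - a : ℝ) : ℂ)) (𝓝[≠] a) (𝓝 D) := by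
    have := hasDerivAt_iff_tendsto_slope.1 (hasDerivAt_profile A B C a).ofReal_comp
    refine this.congr fun y => ?_
    rw [slope, vsub_eq_sub, hF, Complex.ofReal_zero, sub_zero, Complex.real_smul,
      Complex.ofReal_inv, div_eq_inv_mul]
  have sD : Tendsto (fun y : ℝ => ((6 * A * y + B : ℝ) : ℂ)) (𝓝[≠] a) (𝓝 D) := by
    have : Continuous fun y : ℝ => ((6 * A * y + B : ℝ) : ℂ) := by fun_prop
    exact (this.tendsto a).mono_left nhdsWithin_le_nhds
  have hne : ∀ᶠ y : ℝ in 𝓝[≠] a, ((y - a : ℝ) : ℂ) ≠ 0 := by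
    filter_upwards [self_mem_nhdsWithin] with y hy
    exact_mod_cast sub_ne_zero.2 hy
  have r0 := s0.div sF hDc
  have t0 : Tendsto (quot0 A B C f0) (𝓝[≠] a) (𝓝 0) := by
    have := r0.mul hlin
    rw [mul_zero] at this
    refine this.congr' ?_
    filter_upwards [hne] with y hy
    simp only [Pi.div_apply]
    rw [quot0]
    -- At any zero of the profile both sides are `0`, since division by zero gives zero.
    by_cases hp : (profile A B C y : ℂ) = 0
    · simp [hp]
    · field_simp
  have t1 : Tendsto (quot1 A B C f0 f1) (𝓝[≠] a) (𝓝 (f2 a / (2 * D))) := by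
    have := (s1.sub (sD.mul r0)).div sF hDc
    refine (this.congr' ?_).trans (le_of_eq ?_)
    · filter_upwards [hne] with y hy
      simp only [Pi.div_apply]
      rw [quot1, quot0]
      by_cases hp : (profile A B C y : ℂ) = 0
      · simp [hp]
      · field_simp
    · congr 1
      field_simp
      ring
  have key := (Complex.continuous_re.tendsto _).comp (tendsto_flux (ξ := ξ) nhdsWithin_le_nhds
    (h1 a).continuousAt (h2 a).continuousAt h3 t0 t1)
  refine key.trans (le_of_eq ?_)
  rw [← hDdef, ← Complex.normSq_eq_norm_sq]
  have e : -(f2 a * conj (f2 a / (2 * D))) + (D : ℂ) * (f2 a / (2 * D) * conj (f2 a / (2 * D)))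
      = ((-(Complex.normSq (f2 a) / (4 * D)) : ℝ) : ℂ) := by
    rw [map_div₀, map_mul, Complex.conj_ofReal]
    push_cast
    rw [← Complex.mul_conj]
    simp only [map_ofNat]
    field_simp
    ring
  rw [e, Complex.ofReal_re]

/-- The homogeneous problem has only the trivial classical solution. -/
theorem eq_zero_of_homogeneous (hABC : Admissible A B C) (hξ : ξ ≠ 0)
    (h0 : ∀ y, HasDerivAt f0 (f1 y) y) (h1 : ∀ y, HasDerivAt f1 (f2 y) y)
    (h2 : ∀ y, HasDerivAt f2 (f3 y) y) (h3 : ∀ y, HasDerivAt f3 (f4 y) y)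
    (h4 : ∀ y ∈ Ioo (-1 : ℝ) 1, f4 y = -(-2 * (ξ : ℂ) ^ 2 * f2 y + (ξ : ℂ) ^ 4 * f0 y
          - Complex.I * ξ * ((profile A B C y : ℂ) * (f2 y - (ξ : ℂ) ^ 2 * f0 y)
              - 6 * (A : ℂ) * f0 y)))
    (el0 : f0 (-1) = 0) (el1 : f1 (-1) = 0) (er0 : f0 1 = 0) (er1 : f1 1 = 0) :
    ∀ y ∈ Ioo (-1 : ℝ) 1, f0 y = 0 := by
  set R : ℝ → ℝ := fun y => (flux A B C ξ f0 f1 f2 f3 y).re with hR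
  have hA := hABC.2.1
  have hC := hABC.const_pos
  have hd : ∀ y ∈ Ioo (-1 : ℝ) 1, HasDerivAt R (-dissip A B C ξ f0 f1 f2 y) y := fun y hy =>
    hasDerivAt_flux (hABC.profile_pos hy).ne' (h0 y) (h1 y) (h2 y) (h3 y) (h4 y hy)
  have hpos : ∀ y ∈ Ioo (-1 : ℝ) 1, ξ ^ 4 * (profile A B C y * ‖quot0 A B C f0 y‖ ^ 2)
      ≤ dissip A B C ξ f0 f1 f2 y := fun y hy => by
    have := (hABC.profile_pos hy).le
    have hA' : 0 ≤ -(6 * A) := by linarith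
    rw [dissip]
    refine le_add_of_nonneg_left ?_
    positivity
  have hpos' : ∀ y ∈ Ioo (-1 : ℝ) 1, 0 ≤ dissip A B C ξ f0 f1 f2 y := fun y hy => by
    have := (hABC.profile_pos hy).le
    exact le_trans (by positivity) (hpos y hy)
  have hanti : AntitoneOn R (Ioo (-1) 1) := by
    refine antitoneOn_of_deriv_nonpos (convex_Ioo _ _)
      (fun y hy => (hd y hy).continuousAt.continuousWithinAt) ?_ ?_
    · rw [interior_Ioo]
      exact fun y hy => (hd y hy).differentiableAt.differentiableWithinAt
    · rw [interior_Ioo]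
      intro y hy
      rw [(hd y hy).deriv]
      linarith [hpos' y hy]
  obtain ⟨Lr, hLr, tr⟩ : ∃ L, 0 ≤ L ∧ Tendsto R (𝓝[<] 1) (𝓝 L) := by
    by_cases hF : profile A B C 1 = 0
    -- If `𝓕(1) = 0` then `𝓕'(1) = 3A - C`, negative because `A ≤ 0 < C`; the left endpoint is
    -- symmetric.
    · have hD : 6 * A * 1 + B < 0 := by unfold profile at hF; linarith
      refine ⟨_, ?_, (tendsto_flux_of_eq_zero h0 h1 h2 (h3 1).continuousAt er0 er1 hF
        hD.ne).mono_left (nhdsWithin_mono _ fun y hy => ne_of_lt hy)⟩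
      rw [neg_nonneg]
      exact div_nonpos_of_nonneg_of_nonpos (by positivity) (by linarith)
    · exact ⟨0, le_rfl, (tendsto_flux_of_ne_zero h0 h1 h2 (h3 1).continuousAt er0 er1
        hF).mono_left (nhdsWithin_mono _ fun y hy => ne_of_lt hy)⟩
  obtain ⟨Ll, hLl, tl⟩ : ∃ L, L ≤ 0 ∧ Tendsto R (𝓝[>] (-1)) (𝓝 L) := by
    by_cases hF : profile A B C (-1) = 0
    · have hD : 0 < 6 * A * (-1) + B := by unfold profile at hF; linarith
      refine ⟨_, ?_, (tendsto_flux_of_eq_zero h0 h1 h2 (h3 (-1)).continuousAt el0 el1 hF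
        hD.ne').mono_left (nhdsWithin_mono _ fun y hy => ne_of_gt hy)⟩
      rw [neg_nonpos]
      positivity
    · exact ⟨0, le_rfl, (tendsto_flux_of_ne_zero h0 h1 h2 (h3 (-1)).continuousAt el0 el1
        hF).mono_left (nhdsWithin_mono _ fun y hy => ne_of_gt hy)⟩
  have hR0 : ∀ y ∈ Ioo (-1 : ℝ) 1, R y = 0 := by
    intro y hy
    -- A nonincreasing function lies between its endpoint limits: here `0 ≤ Lr ≤ R y ≤ Ll ≤ 0`.
    refine le_antisymm ((ge_of_tendsto tl ?_).trans hLl) (hLr.trans (le_of_tendsto tr ?_))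
    · filter_upwards [Ioo_mem_nhdsGT hy.1] with t ht
      exact hanti ⟨ht.1, ht.2.trans hy.2⟩ hy ht.2.le
    · filter_upwards [Ioo_mem_nhdsLT hy.2] with t ht
      exact hanti hy ⟨hy.1.trans ht.1, ht.2⟩ ht.1.le
  intro y hy
  have hz : HasDerivAt R 0 y := by
    refine (hasDerivAt_const y (0 : ℝ)).congr_of_eventuallyEq ?_
    filter_upwards [isOpen_Ioo.mem_nhds hy] with t ht using hR0 t ht
  have hd0 : dissip A B C ξ f0 f1 f2 y = 0 := by simpa using (hd y hy).unique hz
  have hP := hABC.profile_pos hy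
  have hle : ξ ^ 4 * (profile A B C y * ‖quot0 A B C f0 y‖ ^ 2) ≤ 0 := hd0 ▸ hpos y hy
  have hc : 0 < ξ ^ 4 * profile A B C y := by positivity
  have hq : quot0 A B C f0 y = 0 := by
    by_contra hne
    have : 0 < ‖quot0 A B C f0 y‖ := norm_pos_iff.2 hne
    have : 0 < ξ ^ 4 * profile A B C y * ‖quot0 A B C f0 y‖ ^ 2 := by positivity
    linarith
  have hP' : (profile A B C y : ℂ) ≠ 0 := by exact_mod_cast hP.ne'
  rw [quot0, div_eq_zero_iff] at hq
  exact hq.resolve_right hP'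

end

/-! ### The operator equation -/

/-- The terms of lower order, applied to `φ = ∬ w`, as an operator on `w = φ''`. -/
noncomputable def lower (A B C ξ : ℝ) : L2 →L[ℂ] L2 :=
  (-2 * (ξ : ℂ) ^ 2) • 1 + (ξ : ℂ) ^ 4 • (anti * anti)
    - (Complex.I * ξ) • (mulOp (profile A B C) (continuous_profile A B C) *
        (1 - (ξ : ℂ) ^ 2 • (anti * anti)) - (6 * (A : ℂ)) • (anti * anti))

theorem coeFn_lower (A B C ξ : ℝ) (w : L2) : lower A B C ξ w =ᵐ[μ] fun y =>
    -2 * (ξ : ℂ) ^ 2 * w y + (ξ : ℂ) ^ 4 * anti (anti w) y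
      - Complex.I * ξ * ((profile A B C y : ℂ) * (w y - (ξ : ℂ) ^ 2 * anti (anti w) y)
        - 6 * (A : ℂ) * anti (anti w) y) := by
  set J := anti (anti w)
  set M := mulOp (profile A B C) (continuous_profile A B C)
  have e : lower A B C ξ w = (-2 * (ξ : ℂ) ^ 2) • w + (ξ : ℂ) ^ 4 • J
      - (Complex.I * ξ) • (M (w - (ξ : ℂ) ^ 2 • J) - (6 * (A : ℂ)) • J) := by
    simp [lower, J, M]
  rw [e]
  filter_upwards [Lp.coeFn_sub ((-2 * (ξ : ℂ) ^ 2) • w + (ξ : ℂ) ^ 4 • J)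
      ((Complex.I * ξ) • (M (w - (ξ : ℂ) ^ 2 • J) - (6 * (A : ℂ)) • J)),
    Lp.coeFn_add ((-2 * (ξ : ℂ) ^ 2) • w) ((ξ : ℂ) ^ 4 • J),
    Lp.coeFn_smul (-2 * (ξ : ℂ) ^ 2) w, Lp.coeFn_smul ((ξ : ℂ) ^ 4) J,
    Lp.coeFn_smul (Complex.I * ξ) (M (w - (ξ : ℂ) ^ 2 • J) - (6 * (A : ℂ)) • J),
    Lp.coeFn_sub (M (w - (ξ : ℂ) ^ 2 • J)) ((6 * (A : ℂ)) • J),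
    Lp.coeFn_smul (6 * (A : ℂ)) J, coeFn_mulOp _ (continuous_profile A B C) (w - (ξ : ℂ) ^ 2 • J),
    Lp.coeFn_sub w ((ξ : ℂ) ^ 2 • J), Lp.coeFn_smul ((ξ : ℂ) ^ 2) J]
    with y h1 h2 h3 h4 h5 h6 h7 h8 h9 h10
  rw [h1, Pi.sub_apply, h2, Pi.add_apply, h3, h4, h5]
  simp only [Pi.smul_apply, smul_eq_mul]
  rw [h6, Pi.sub_apply, h7, h8, h9, Pi.sub_apply, h10]
  simp only [Pi.smul_apply, smul_eq_mul]

/-! ### Continuous representatives and regularity -/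

theorem hasDerivAt_integral {k : ℝ → ℂ} (hk : Continuous k) (y : ℝ) :
    HasDerivAt (fun y => ∫ t in (-1)..y, k t) (k y) y :=
  intervalIntegral.integral_hasDerivAt_right (hk.intervalIntegrable _ _)
    (hk.stronglyMeasurableAtFilter _ _) hk.continuousAt

theorem continuous_integral {k : ℝ → ℂ} (hk : Continuous k) :
    Continuous fun y => ∫ t in (-1)..y, k t :=
  continuous_iff_continuousAt.2 fun y => (hasDerivAt_integral hk y).continuousAt

theorem anti_ae_eq {u : L2} {k : ℝ → ℂ} (h : u =ᵐ[μ] k) :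
    anti u =ᵐ[μ] fun y => ∫ t in (-1)..y, k t := by
  filter_upwards [coeFn_anti u, ae_restrict_mem measurableSet_Ioo] with y hy hm
  rw [hy, prim_eq_intervalIntegral h (Ioo_subset_Icc_self hm)]

theorem lower_ae_eq (A B C ξ : ℝ) {w : L2} {k : ℝ → ℂ} (h : w =ᵐ[μ] k) :
    lower A B C ξ w =ᵐ[μ] fun y =>
    -2 * (ξ : ℂ) ^ 2 * k y + (ξ : ℂ) ^ 4 * (∫ s in (-1)..y, ∫ t in (-1)..s, k t)
      - Complex.I * ξ * ((profile A B C y : ℂ) *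
          (k y - (ξ : ℂ) ^ 2 * ∫ s in (-1)..y, ∫ t in (-1)..s, k t)
        - 6 * (A : ℂ) * ∫ s in (-1)..y, ∫ t in (-1)..s, k t) := by
  filter_upwards [coeFn_lower A B C ξ w, h, anti_ae_eq (anti_ae_eq h)] with y h1 h2 h3
  rw [h1, h2, h3]

theorem bil_one_eq_integral {u : L2} {k : ℝ → ℂ} (h : u =ᵐ[μ] k) :
    bil one u = ∫ t in (-1)..1, k t := by
  rw [bil_one_eq_prim, prim_eq_intervalIntegral h (by norm_num)]

theorem anti_one_ae_eq : anti one =ᵐ[μ] fun y => ((y + 1 : ℝ) : ℂ) := by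
  filter_upwards [anti_ae_eq coeFn_one] with y hy
  rw [hy]
  simp

/-- Elliptic regularity and uniqueness for the homogeneous operator equation. -/
theorem eq_zero_of_add_lower_mem_affine {A B C ξ : ℝ} (hABC : Admissible A B C) (hξ : ξ ≠ 0)
    {w : L2} (hw : w ∈ affineᗮ) (h : w + anti (anti (lower A B C ξ w)) ∈ affine) : w = 0 := by
  obtain ⟨a, b, hab⟩ := Submodule.mem_span_pair.1 h
  have hw' : w = a • one + b • anti one - anti (anti (lower A B C ξ w)) := by
    rw [hab]; abel
  have hae : ∀ {k : ℝ → ℂ}, anti (anti (lower A B C ξ w)) =ᵐ[μ] k →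
      w =ᵐ[μ] fun y => a + b * ((y + 1 : ℝ) : ℂ) - k y := by
    intro k hk
    filter_upwards [Lp.coeFn_sub (a • one + b • anti one) (anti (anti (lower A B C ξ w))),
      Lp.coeFn_add (a • one) (b • anti one), Lp.coeFn_smul a one, Lp.coeFn_smul b (anti one),
      coeFn_one, anti_one_ae_eq, hk] with y h1 h2 h3 h4 h5 h6 h7
    rw [hw', h1, Pi.sub_apply, h2, Pi.add_apply, h3, h4, Pi.smul_apply, Pi.smul_apply, h5, h6,
      h7, smul_eq_mul, smul_eq_mul, mul_one]
  have hcont : ∀ {k : ℝ → ℂ}, Continuous k →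
      Continuous fun y : ℝ => a + b * ((y + 1 : ℝ) : ℂ) - k y := fun hk => by fun_prop
  have hPc : Continuous fun y : ℝ => (profile A B C y : ℂ) :=
    Complex.continuous_ofReal.comp (continuous_profile A B C)
  have hlc : ∀ {k : ℝ → ℂ}, Continuous k → Continuous fun y =>
    -2 * (ξ : ℂ) ^ 2 * k y + (ξ : ℂ) ^ 4 * (∫ s in (-1)..y, ∫ t in (-1)..s, k t)
      - Complex.I * ξ * ((profile A B C y : ℂ) *
          (k y - (ξ : ℂ) ^ 2 * ∫ s in (-1)..y, ∫ t in (-1)..s, k t)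
        - 6 * (A : ℂ) * ∫ s in (-1)..y, ∫ t in (-1)..s, k t) := fun hk => by
    have := continuous_integral (continuous_integral hk)
    fun_prop
  -- Bootstrap: `w` is affine minus a continuous antiderivative, hence continuous. Then `lower w`
  -- has a continuous representative `g`, and `w` equals a `C²` function whose second derivative is
  -- `-g`.
  have hw1 := hae (coeFn_anti (anti (lower A B C ξ w)))
  have hc1 := hcont (continuous_prim (anti (lower A B C ξ w)))
  have hg := lower_ae_eq A B C ξ hw1
  have hgc := hlc hc1
  set g := fun y => -2 * (ξ : ℂ) ^ 2 * _ + _ - _ with hgdef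
  clear_value g
  have hw2 := hae (anti_ae_eq (anti_ae_eq hg))
  have hc2 := hcont (continuous_integral (continuous_integral hgc))
  have hg2 := lower_ae_eq A B C ξ hw2
  have hgc2 := hlc hc2
  have hd2 : ∀ y, HasDerivAt (fun y : ℝ => a + b * ((y + 1 : ℝ) : ℂ)
      - ∫ s in (-1)..y, ∫ t in (-1)..s, g t) (b - ∫ t in (-1)..y, g t) y := fun y => by
    have h1 : HasDerivAt (fun y : ℝ => ((y + 1 : ℝ) : ℂ)) 1 y := by
      simpa using ((hasDerivAt_id y).add_const 1).ofReal_comp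
    refine (((h1.const_mul b).const_add a).sub
      (hasDerivAt_integral (continuous_integral hgc) y)).congr_deriv ?_
    rw [mul_one]
  set f2 := fun y : ℝ => a + b * ((y + 1 : ℝ) : ℂ) - ∫ s in (-1)..y, ∫ t in (-1)..s, g t
  -- Two continuous representatives of `lower w` agree everywhere on the open interval, which makes
  -- the differential equation hold pointwise.
  have hge := Measure.eqOn_open_of_ae_eq (hg.symm.trans hg2) isOpen_Ioo hgc.continuousOn
    hgc2.continuousOn
  obtain ⟨hb1, hb2⟩ := mem_affine_orthogonal.1 hw
  rw [bil_one_eq_integral hw2] at hb1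
  rw [bil_one_eq_integral (anti_ae_eq hw2)] at hb2
  have hd1 := hasDerivAt_integral hc2
  have hd0 := hasDerivAt_integral (continuous_integral hc2)
  have key := eq_zero_of_homogeneous (ξ := ξ) hABC hξ hd0 hd1 hd2
    (fun y => (hasDerivAt_integral hgc y).const_sub b) (fun y hy => by rw [hge hy])
    (by simp) (by simp) hb2 hb1
  have hz : ∀ {k k' : ℝ → ℂ}, (∀ y, HasDerivAt k (k' y) y) → (∀ y ∈ Ioo (-1 : ℝ) 1, k y = 0) →
      ∀ y ∈ Ioo (-1 : ℝ) 1, k' y = 0 := fun hk h0 y hy =>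
    (hk y).unique ((hasDerivAt_const y (0 : ℂ)).congr_of_eventuallyEq (by
      filter_upwards [isOpen_Ioo.mem_nhds hy] with t ht using h0 t ht))
  refine (Lp.eq_zero_iff_ae_eq_zero).2 ?_
  filter_upwards [hw2, ae_restrict_mem measurableSet_Ioo] with y h1 h2
  rw [h1, hz hd1 (hz hd0 key) y h2]
  rfl

/-- The orthogonal projection onto the second derivatives of functions in `H²₀`. -/
noncomputable def proj : L2 →L[ℂ] L2 := affineᗮ.starProjection

theorem proj_eq_self_iff {w : L2} : proj w = w ↔ w ∈ affineᗮ :=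
  Submodule.starProjection_eq_self_iff

theorem proj_mem (w : L2) : proj w ∈ affineᗮ := Submodule.starProjection_apply_mem _ _

theorem proj_eq_zero_iff {w : L2} : proj w = 0 ↔ w ∈ affine := by
  rw [proj, Submodule.starProjection_apply_eq_zero_iff, Submodule.orthogonal_orthogonal]

/-- The operator of the boundary value problem, acting on `φ''`. -/
noncomputable def bvp (A B C ξ : ℝ) : L2 →L[ℂ] L2 :=
  1 + proj * (anti * (anti * lower A B C ξ)) * proj

theorem bvp_apply (A B C ξ : ℝ) (w : L2) :
    bvp A B C ξ w = w + proj (anti (anti (lower A B C ξ (proj w)))) := rfl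

theorem mem_of_bvp_eq {A B C ξ : ℝ} {w z : L2} (h : bvp A B C ξ w = proj z) : w ∈ affineᗮ := by
  rw [bvp_apply] at h
  rw [eq_sub_of_add_eq h]
  exact sub_mem (proj_mem _) (proj_mem _)

/-- Fredholm alternative at `-1` for a compact operator: either `bvp` is invertible or it has a
nonzero kernel vector, which uniqueness for the homogeneous problem excludes. At `ξ = 0` every lower
order term vanishes. -/
theorem isUnit_bvp {A B C : ℝ} (hABC : Admissible A B C) (ξ : ℝ) : IsUnit (bvp A B C ξ) := by
  by_cases hξ : ξ = 0
  · have : bvp A B C ξ = 1 := by simp [bvp, lower, hξ]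
    rw [this]
    exact isUnit_one
  have hK : IsCompactOperator (proj * (anti * (anti * lower A B C ξ)) * proj : L2 →L[ℂ] L2) :=
    ((isCompactOperator_anti.comp_clm (anti * lower A B C ξ)).clm_comp proj).comp_clm proj
  rcases hK.hasEigenvalue_or_mem_resolventSet (μ := -1) (by norm_num) with h | h
  · obtain ⟨w, hw⟩ := h.exists_hasEigenvector
    -- The right side is written as `proj 0` so that `mem_of_bvp_eq` puts `w` in `affineᗮ`.
    have h1 : bvp A B C ξ w = proj 0 := by
      have h2 : proj (anti (anti (lower A B C ξ (proj w)))) = (-1 : ℂ) • w := hw.apply_eq_smul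
      rw [bvp_apply, h2]
      simp
    have hm := mem_of_bvp_eq h1
    refine absurd (eq_zero_of_add_lower_mem_affine hABC hξ hm ?_) hw.2
    rw [← proj_eq_zero_iff, map_add, proj_eq_self_iff.2 hm]
    rwa [bvp_apply, map_zero, proj_eq_self_iff.2 hm] at h1
  · rw [spectrum.mem_resolventSet_iff] at h
    convert h.neg using 1
    rw [bvp, neg_sub, map_neg, map_one, sub_neg_eq_add, add_comm]

/-- Inversion is continuous on units, so the inverse is continuous in `ξ` and bounded on a compact
interval. The interval contains `0`, so nothing degenerates as `ξ → 0`. -/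
theorem exists_bound_bvp {A B C : ℝ} (hABC : Admissible A B C) (r : ℝ) :
    ∃ K, 0 ≤ K ∧ ∀ ξ ∈ Icc (-r) r, ∀ w : L2, ‖w‖ ≤ K * ‖bvp A B C ξ w‖ := by
  have hc : Continuous fun ξ : ℝ => bvp A B C ξ := by
    unfold bvp lower
    fun_prop
  have hi : Continuous fun ξ : ℝ => Ring.inverse (bvp A B C ξ) := by
    refine continuous_iff_continuousAt.2 fun ξ => ?_
    obtain ⟨u, hu⟩ := isUnit_bvp hABC ξ
    have := NormedRing.inverse_continuousAt u
    rw [hu] at this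
    exact ContinuousAt.comp (f := fun ξ : ℝ => bvp A B C ξ) this hc.continuousAt
  obtain ⟨K, hK⟩ := isCompact_Icc.exists_bound_of_continuousOn (s := Icc (-r) r) hi.continuousOn
  refine ⟨max K 0, le_max_right _ _, fun ξ hξ w => ?_⟩
  have h1 : w = Ring.inverse (bvp A B C ξ) (bvp A B C ξ w) := by
    rw [← mul_apply_eq_comp, Ring.inverse_mul_cancel _ (isUnit_bvp hABC ξ)]
    rfl
  conv_lhs => rw [h1]
  refine (ContinuousLinearMap.le_opNorm _ _).trans ?_
  gcongr
  exact (hK ξ hξ).trans (le_max_left _ _)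

/-! ### Functionals on `H^1_0` -/

/-- The element of `H^1_0` with a given derivative of mean zero. -/
noncomputable def mkH0One (u : L2) (hu : bil one u = 0) : H0 1 := ⟨liftOne u, liftOne_mem_H0 hu⟩

theorem mkH0One_apply_zero (u : L2) (hu : bil one u = 0) : (mkH0One u hu).1.1 0 = anti u := rfl

theorem mkH0One_apply_one (u : L2) (hu : bil one u = 0) : (mkH0One u hu).1.1 1 = u := rfl

theorem eq_mkH0One (v : H0 1) : v = mkH0One (v.1.1 1) (H0_one_property v.2).2 := by
  refine Subtype.ext (Subtype.ext (PiLp.ext fun j => ?_))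
  fin_cases j
  · exact (H0_one_property v.2).1
  · rfl

theorem norm_dual_apply_le {F : Type*} [SeminormedAddCommGroup F] [NormedSpace ℂ F]
    (h : StrongDual ℂ F) (v : F) : ‖h v‖ ≤ ‖h‖ * ‖v‖ := h.le_opNorm v

theorem norm_dual_le {F : Type*} [SeminormedAddCommGroup F] [NormedSpace ℂ F]
    (h : StrongDual ℂ F) {c : ℝ} (hc : 0 ≤ c) (hb : ∀ v, ‖h v‖ ≤ c * ‖v‖) : ‖h‖ ≤ c :=
  h.opNorm_le_bound hc hb

/-- The bound for functionals on `H^1_0`. -/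
theorem norm_HNegOne_apply_le (h : HNegOne) (v : H0 1) : ‖h v‖ ≤ ‖h‖ * ‖v‖ := by
  have := norm_dual_apply_le (F := H0 1)
  exact this h v

/-- A functional in `H⁻¹` is the distributional derivative of a function in `L²`. -/
theorem exists_bil_eq (h : HNegOne) :
    ∃ f : L2, ‖f‖ ≤ ‖liftOne‖ * ‖h‖ ∧ ∀ v : H0 1, h v = bil f (v.1.1 1) := by
  let D : Submodule ℂ L2 := LinearMap.ker (bil one : L2 →ₗ[ℂ] ℂ)
  let T : D →L[ℂ] H0 1 := (liftOne ∘L D.subtypeL).codRestrict (H0 1) fun u => liftOne_mem_H0 u.2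
  have hT : ‖h ∘L T‖ ≤ ‖liftOne‖ * ‖h‖ := norm_dual_le _ (by positivity) fun u => by
    rw [ContinuousLinearMap.comp_apply, mul_comm ‖liftOne‖, mul_assoc]
    refine (norm_HNegOne_apply_le h (T u)).trans ?_
    gcongr
    exact liftOne.le_opNorm u
  -- `h` acts on `v'`, which ranges over mean-zero functions. A norm-preserving extension to `L²`
  -- and Riesz representation give `f`; conjugation turns the inner product into the bilinear
  -- pairing.
  obtain ⟨g, hg, hgn⟩ := exists_extension_norm_eq D (h ∘L T)
  have hr : ∀ u, bil (star ((InnerProductSpace.toDual ℂ L2).symm g)) u = g u := fun u => by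
    rw [bil_eq_inner, star_star, InnerProductSpace.toDual_symm_apply]
  refine ⟨star ((InnerProductSpace.toDual ℂ L2).symm g), ?_, fun v => ?_⟩
  · rw [norm_star_L2, LinearIsometryEquiv.norm_map, hgn]
    exact hT
  · have hv := (H0_one_property v.2).2
    rw [hr]
    have := hg ⟨v.1.1 1, hv⟩
    rw [this, ContinuousLinearMap.comp_apply]
    congr 1
    exact eq_mkH0One v

/-- The double orthogonal complement of the line of constants is that line. -/
theorem eq_const_of_bil_eq_zero {z : L2} (h : ∀ u : L2, bil one u = 0 → bil z u = 0) :
    ∃ c : ℂ, z = c • one := by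
  have h1 : star z ∈ ((ℂ ∙ one)ᗮ)ᗮ := by
    refine (Submodule.mem_orthogonal' _ _).2 fun u hu => ?_
    rw [← bil_eq_inner]
    refine h u ?_
    rwa [bil_eq_inner, star_one_L2, ← Submodule.mem_orthogonal_singleton_iff_inner_right]
  rw [Submodule.orthogonal_orthogonal] at h1
  obtain ⟨c, hc⟩ := Submodule.mem_span_singleton.1 h1
  exact ⟨star c, by rw [← star_star z, ← hc, star_smul_L2, star_one_L2]⟩

theorem norm_apply_zero_le (v : H0 1) : ‖v.1.1 0‖ ≤ ‖v‖ := PiLp.norm_apply_le v.1.1 0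

theorem IsGivenBy.norm_le {h : HNegOne} {g : L2} (hg : IsGivenBy h g) : ‖h‖ ≤ ‖g‖ := by
  have := norm_dual_le (F := H0 1)
  refine this h (norm_nonneg _) fun v => ?_
  · rw [hg v]
    refine (norm_bil_le g (v.1.1 0)).trans ?_
    gcongr
    exact norm_apply_zero_le v

/-! ### Solutions in terms of the second derivative -/

section
variable {A B C ξ : ℝ} {h : HNegOne}

theorem integral_lower_mul (φ : H 3) (h0 : φ.1 0 = anti (anti (φ.1 2))) (v : L2) :
    ∫ y, (-2 * (ξ : ℂ) ^ 2 * φ.1 2 y + (ξ : ℂ) ^ 4 * φ.1 0 y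
          - Complex.I * ξ * ((profile A B C y : ℂ) * (φ.1 2 y - (ξ : ℂ) ^ 2 * φ.1 0 y)
              - 6 * (A : ℂ) * φ.1 0 y)) * v y ∂μ = bil (lower A B C ξ (φ.1 2)) v := by
  rw [h0]
  exact integral_congr_ae ((coeFn_lower A B C ξ (φ.1 2)).mono fun y hy => by simp only [hy])

theorem exists_mem_H0_two_iff (φ : H 3) : (∃ ψ ∈ H0 2, ψ.1 0 = φ.1 0) ↔
    φ.1 2 ∈ affineᗮ ∧ φ.1 1 = anti (φ.1 2) ∧ φ.1 0 = anti (anti (φ.1 2)) := by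
  have h1 : IsWeakDeriv 1 (φ.1 0) (φ.1 1) := φ.2 1
  have h2 : IsWeakDeriv 2 (φ.1 0) (φ.1 2) := φ.2 2
  constructor
  · rintro ⟨ψ, hψ, e⟩
    obtain ⟨p0, p1, p2, p3⟩ := H0_two_property hψ
    have k1 : IsWeakDeriv 1 (ψ.1 0) (ψ.1 1) := ψ.2 1
    have k2 : IsWeakDeriv 2 (ψ.1 0) (ψ.1 2) := ψ.2 2
    rw [e] at k1 k2
    have e1 := k1.unique h1
    have e2 := k2.unique h2
    rw [e, p1, e2] at p0
    rw [e1, e2] at p1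
    rw [e1, p1] at p2
    rw [e2] at p3
    exact ⟨mem_affine_orthogonal.2 ⟨p3, p2⟩, p1, p0⟩
  · rintro ⟨hw, -, e0⟩
    exact ⟨_, liftTwo_mem_H0 hw, e0.symm⟩

theorem H3_eq_anti_add (φ : H 3) : ∃ c : ℂ, φ.1 2 = anti (φ.1 3) + c • one := by
  have h2 : IsWeakDeriv 2 (φ.1 0) (φ.1 2) := φ.2 2
  have h3 : IsWeakDeriv (1 + 2) (φ.1 0) (φ.1 3) := φ.2 3
  exact (h2.of_add h3).eq_anti_add

/-- Integration by parts moves the lower order terms onto `v'`, so the equation says that one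
function annihilates every mean-zero `v'`, that is, it is constant. -/
theorem isSolution_iff {f : L2} (hf : ∀ v : H0 1, h v = bil f (v.1.1 1)) (φ : H 3) :
    IsSolution A B C ξ h φ ↔ φ.1 2 ∈ affineᗮ ∧ φ.1 1 = anti (φ.1 2) ∧
      φ.1 0 = anti (anti (φ.1 2)) ∧
      ∃ c : ℂ, φ.1 3 + anti (lower A B C ξ (φ.1 2)) + f = c • one := by
  have key : φ.1 0 = anti (anti (φ.1 2)) → ∀ v : H0 1,
      (-(∫ y, φ.1 3 y * v.1.1 1 y ∂μ)
      + (∫ y, (-2 * (ξ : ℂ) ^ 2 * φ.1 2 y + (ξ : ℂ) ^ 4 * φ.1 0 y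
          - Complex.I * ξ * ((profile A B C y : ℂ) * (φ.1 2 y - (ξ : ℂ) ^ 2 * φ.1 0 y)
              - 6 * (A : ℂ) * φ.1 0 y)) * v.1.1 0 y ∂μ) = h v ↔
        bil (φ.1 3 + anti (lower A B C ξ (φ.1 2)) + f) (v.1.1 1) = 0) := by
    intro e0 v
    obtain ⟨p0, p1⟩ := H0_one_property v.2
    have h1 := bil_anti_add (lower A B C ξ (φ.1 2)) (v.1.1 1)
    rw [p1, mul_zero, ← p0] at h1
    rw [integral_lower_mul φ e0, hf, ← bil_apply, map_add, map_add, add_apply, add_apply,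
      eq_neg_of_add_eq_zero_left h1]
    constructor
    · intro h; linear_combination -h
    · intro h; linear_combination -h
  constructor
  · rintro ⟨hm, he⟩
    obtain ⟨hw, e1, e0⟩ := (exists_mem_H0_two_iff φ).1 hm
    refine ⟨hw, e1, e0, eq_const_of_bil_eq_zero fun u hu => ?_⟩
    exact (key e0 (mkH0One u hu)).1 (he _)
  · rintro ⟨hw, e1, e0, c, hc⟩
    refine ⟨(exists_mem_H0_two_iff φ).2 ⟨hw, e1, e0⟩, fun v => (key e0 v).2 ?_⟩
    rw [hc, map_smul, smul_apply, (H0_one_property v.2).2, smul_zero]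

theorem one_mem_affine : one ∈ affine := Submodule.subset_span (by simp)

theorem anti_one_mem_affine : anti one ∈ affine := Submodule.subset_span (by simp)

/-- Integrating the relation for `φ'''` once more adds a second constant; together they form an
affine function, which `proj` kills. -/
theorem bvp_eq_of_isSolution {f : L2} (hf : ∀ v : H0 1, h v = bil f (v.1.1 1)) {φ : H 3}
    (hφ : IsSolution A B C ξ h φ) : bvp A B C ξ (φ.1 2) = proj (-anti f) := by
  obtain ⟨hw, -, -, c, hc⟩ := (isSolution_iff hf φ).1 hφ
  obtain ⟨d, hd⟩ := H3_eq_anti_add φ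
  have h3 : φ.1 3 = c • one - anti (lower A B C ξ (φ.1 2)) - f := by rw [← hc]; abel
  rw [h3, map_sub, map_sub, map_smul] at hd
  rw [bvp_apply, proj_eq_self_iff.2 hw, ← sub_eq_zero]
  nth_rw 1 [← proj_eq_self_iff.2 hw]
  rw [← map_add, ← map_sub, proj_eq_zero_iff]
  have e : φ.1 2 + anti (anti (lower A B C ξ (φ.1 2))) - -anti f = c • anti one + d • one := by
    nth_rw 1 [hd]
    abel
  rw [e]
  exact add_mem (Submodule.smul_mem _ _ anti_one_mem_affine)
    (Submodule.smul_mem _ _ one_mem_affine)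

theorem bvp_injective (hABC : Admissible A B C) : Function.Injective (bvp A B C ξ) := by
  obtain ⟨u, hu⟩ := isUnit_bvp hABC ξ
  refine Function.LeftInverse.injective (g := (↑u⁻¹ : L2 →L[ℂ] L2)) fun x => ?_
  rw [← hu, ← mul_apply_eq_comp, Units.inv_mul]
  rfl

theorem bvp_surjective (hABC : Admissible A B C) : Function.Surjective (bvp A B C ξ) := by
  obtain ⟨u, hu⟩ := isUnit_bvp hABC ξ
  refine fun x => ⟨(↑u⁻¹ : L2 →L[ℂ] L2) x, ?_⟩
  rw [← hu, ← mul_apply_eq_comp, Units.mul_inv]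
  rfl

/-- A function in `H³` with given third derivative, vanishing with its derivative at `-1`. -/
theorem exists_H3 (v : L2) (c : ℂ) : ∃ φ : H 3, φ.1 3 = v ∧ φ.1 2 = anti v + c • one ∧
    φ.1 1 = anti (anti v + c • one) ∧ φ.1 0 = anti (anti (anti v + c • one)) := by
  refine ⟨⟨WithLp.toLp 2 ![anti (anti (anti v + c • one)), anti (anti v + c • one),
    anti v + c • one, v], fun j => ?_⟩, rfl, rfl, rfl, rfl⟩
  have h1 := isWeakDeriv_anti (anti (anti v + c • one))
  have h2 := isWeakDeriv_anti (anti v + c • one)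
  have h3 := isWeakDeriv_anti_add v c
  fin_cases j
  · exact isWeakDeriv_zero_self _
  · exact h1
  · exact h1.comp h2
  · exact (h1.comp h2).comp h3

theorem existsUnique_isSolution (hABC : Admissible A B C) :
    ∃! φ : H 3, IsSolution A B C ξ h φ := by
  obtain ⟨f, -, hf⟩ := exists_bil_eq h
  obtain ⟨w, hw⟩ := bvp_surjective (ξ := ξ) hABC (proj (-anti f))
  have hm := mem_of_bvp_eq hw
  have ha : w + anti (anti (lower A B C ξ w)) - -anti f ∈ affine := by
    rw [← proj_eq_zero_iff, map_sub, map_add, proj_eq_self_iff.2 hm, sub_eq_zero, ← hw, bvp_apply,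
      proj_eq_self_iff.2 hm]
  obtain ⟨a, b, hab⟩ := Submodule.mem_span_pair.1 ha
  -- The affine remainder `a + b(y + 1)` supplies both constants of integration: `b` enters `φ'''`,
  -- and `a` is the value of `φ''` at `-1`.
  obtain ⟨φ, p3, p2, p1, p0⟩ := exists_H3 (b • one - anti (lower A B C ξ w) - f) a
  have e : anti (b • one - anti (lower A B C ξ w) - f) + a • one = w := by
    have : w = a • one + b • anti one - anti (anti (lower A B C ξ w)) - anti f := by
      rw [hab]; abel
    rw [map_sub, map_sub, map_smul]
    nth_rw 2 [this]
    abel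
  rw [e] at p2 p1 p0
  refine ⟨φ, (isSolution_iff hf φ).2 ⟨p2 ▸ hm, by rw [p1, p2], by rw [p0, p2], b, ?_⟩, ?_⟩
  · rw [p3, p2]; abel
  · intro φ' hφ'
    have h2 : φ'.1 2 = φ.1 2 := by
      refine bvp_injective (ξ := ξ) hABC ?_
      rw [bvp_eq_of_isSolution hf hφ', p2, hw]
    obtain ⟨-, q1, q0, -⟩ := (isSolution_iff hf φ').1 hφ'
    have h0 : φ'.1 0 = φ.1 0 := by rw [q0, h2, p0, p2]
    refine Subtype.ext (PiLp.ext fun j => ?_)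
    have k := φ'.2 j
    rw [h0] at k
    exact k.unique (φ.2 j)

/-! ### Estimates -/

theorem integral_norm_sq (u : L2) : ∫ y, ‖u y‖ ^ 2 ∂μ = ‖u‖ ^ 2 := by
  have h1 := bil_star_self u
  rw [bil_comm, bil_eq_inner, star_star, L2.inner_def] at h1
  have h2 : ∫ y, inner ℂ (u y) (u y) ∂μ = ((∫ y, ‖u y‖ ^ 2 ∂μ : ℝ) : ℂ) := by
    rw [← integral_complex_ofReal]
    refine integral_congr_ae (ae_of_all _ fun y => ?_)
    simp only [inner_self_eq_norm_sq_to_K]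
    simp
  rw [h2] at h1
  exact_mod_cast h1

theorem energy_eq (φ : H 3) :
    energy ξ φ = ‖φ.1 2‖ ^ 2 + 2 * ξ ^ 2 * ‖φ.1 1‖ ^ 2 + ξ ^ 4 * ‖φ.1 0‖ ^ 2 := by
  have hi : ∀ u : L2, Integrable (fun y => ‖u y‖ ^ 2) μ := fun u =>
    (Lp.memLp u).integrable_norm_pow (by norm_num)
  have hs : Integrable (fun y => ‖φ.1 2 y‖ ^ 2 + 2 * ξ ^ 2 * ‖φ.1 1 y‖ ^ 2) μ :=
    (hi _).add ((hi _).const_mul _)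
  rw [energy, integral_add hs ((hi _).const_mul _),
    integral_add (hi _) ((hi _).const_mul _), integral_const_mul, integral_const_mul,
    integral_norm_sq, integral_norm_sq, integral_norm_sq]

theorem im_bil_mulOp_star (a : ℝ → ℝ) (ha : Continuous a) (u : L2) :
    (bil (mulOp a ha u) (star u)).im = 0 := by
  have : bil (mulOp a ha u) (star u) = ((∫ y, a y * ‖u y‖ ^ 2 ∂μ : ℝ) : ℂ) := by
    rw [← integral_complex_ofReal, bil_apply]
    refine integral_congr_ae ?_
    filter_upwards [coeFn_mulOp a ha u, Lp.coeFn_star u] with y h1 h2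
    rw [h1, h2, Pi.star_apply, mul_assoc]
    have : u y * star (u y) = (‖u y‖ : ℂ) ^ 2 := RCLike.mul_conj (u y)
    rw [this]
    push_cast
    rfl
  rw [this, Complex.ofReal_im]

/-- The energy identity, as an inequality for large frequencies. -/
theorem energy_le_of_large {r : ℝ}
    (hr : ‖mulOp (profile A B C) (continuous_profile A B C)‖ ≤ r) (hξ : r ≤ |ξ|) {φ : H 3}
    (hφ : IsSolution A B C ξ h φ) :
    ∃ v : H0 1, v.1.1 0 = star (φ.1 0) ∧ ‖v‖ ^ 2 = ‖φ.1 0‖ ^ 2 + ‖φ.1 1‖ ^ 2 ∧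
      energy ξ φ ≤ 2 * ‖h v‖ := by
  obtain ⟨hw, e1, e0⟩ := (exists_mem_H0_two_iff φ).1 hφ.mem_H0_two
  obtain ⟨m1, m2⟩ := mem_affine_orthogonal.1 hw
  have hs : ∀ u, bil one u = 0 → bil one (star u) = 0 := fun u hu => by
    rw [← star_one_L2, bil_star, hu, star_zero]
  have m1' := hs _ m1
  have m2' := hs _ m2
  have v0 : (mkH0One _ m2').1.1 0 = star (φ.1 0) := by
    rw [mkH0One_apply_zero, anti_star, e0]
  refine ⟨mkH0One _ m2', v0, ?_, ?_⟩
  · have : ‖mkH0One _ m2'‖ ^ 2 = ‖(mkH0One _ m2').1.1 0‖ ^ 2 + ‖(mkH0One _ m2').1.1 1‖ ^ 2 := by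
      have := PiLp.norm_sq_eq_of_L2 (fun _ : Fin 2 => L2) (mkH0One _ m2').1.1
      rw [Fin.sum_univ_two] at this
      exact this
    rw [this, v0, mkH0One_apply_one, norm_star_L2, norm_star_L2, e1]
  have heq := hφ.equation (mkH0One _ m2')
  rw [integral_lower_mul φ e0, ← bil_apply, v0, mkH0One_apply_one] at heq
  obtain ⟨c, hc⟩ := H3_eq_anti_add φ
  have k1 : bil (φ.1 3) (star (anti (φ.1 2))) = -(‖φ.1 2‖ : ℂ) ^ 2 := by
    have := bil_anti_add (φ.1 3) (star (φ.1 2))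
    rw [m1', mul_zero, anti_star, eq_sub_of_add_eq hc.symm, map_sub, map_smul, sub_apply,
      smul_apply, m1', smul_zero, sub_zero, bil_star_self] at this
    exact eq_neg_of_add_eq_zero_left this
  have k2 : bil (φ.1 2) (star (φ.1 0)) = -(‖φ.1 1‖ : ℂ) ^ 2 := by
    have := bil_anti_add (φ.1 2) (star (anti (φ.1 2)))
    rw [m2', mul_zero, anti_star, ← e0, ← e1, bil_star_self] at this
    exact eq_neg_of_add_eq_zero_left this
  set M := mulOp (profile A B C) (continuous_profile A B C)
  have k3 := im_bil_mulOp_star (profile A B C) (continuous_profile A B C) (φ.1 0)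
  have el : lower A B C ξ (φ.1 2) = (-2 * (ξ : ℂ) ^ 2) • φ.1 2 + (ξ : ℂ) ^ 4 • φ.1 0
      - (Complex.I * ξ) • (M (φ.1 2) - (ξ : ℂ) ^ 2 • M (φ.1 0) - (6 * (A : ℂ)) • φ.1 0) := by
    rw [e0]
    simp [lower, M]
  rw [k1, el] at heq
  simp only [map_add, map_sub, map_smul, add_apply, sub_apply, smul_apply, smul_eq_mul, k2,
    bil_star_self] at heq
  have hre : energy ξ φ = (h (mkH0One _ m2')).re - ξ * (bil (M (φ.1 2)) (star (φ.1 0))).im := by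
    rw [energy_eq, ← heq]
    have k3' : (bil (M (φ.1 0)) (star (φ.1 0))).im = 0 := k3
    simp [pow_succ, k3']
    ring
  -- The only term without a sign: `‖𝓕‖ ≤ r ≤ |ξ|` turns it into `‖φ''‖ · ξ²‖φ‖`, at most half the
  -- energy by the arithmetic–geometric inequality.
  have hle : |ξ * (bil (M (φ.1 2)) (star (φ.1 0))).im| ≤ energy ξ φ / 2 := by
    have b1 : |(bil (M (φ.1 2)) (star (φ.1 0))).im| ≤ r * ‖φ.1 2‖ * ‖φ.1 0‖ := by
      refine (Complex.abs_im_le_norm _).trans ((norm_bil_le _ _).trans ?_)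
      rw [norm_star_L2]
      gcongr
      exact (M.le_opNorm _).trans (by gcongr)
    have b2 : ξ ^ 2 = |ξ| ^ 2 := (sq_abs ξ).symm
    calc |ξ * (bil (M (φ.1 2)) (star (φ.1 0))).im|
        ≤ |ξ| * (|ξ| * ‖φ.1 2‖ * ‖φ.1 0‖) := by
          rw [abs_mul]
          gcongr
          exact b1.trans (by gcongr)
      _ = ‖φ.1 2‖ * (ξ ^ 2 * ‖φ.1 0‖) := by rw [b2]; ring
      _ ≤ energy ξ φ / 2 := by
          rw [energy_eq]
          have : 0 ≤ 2 * ξ ^ 2 * ‖φ.1 1‖ ^ 2 := by positivity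
          nlinarith [sq_nonneg (‖φ.1 2‖ - ξ ^ 2 * ‖φ.1 0‖)]
  have h5 := (abs_le.1 hle).1
  have h6 := Complex.re_le_norm (h (mkH0One _ m2'))
  linarith

/-- Since `φ'` and `φ` are antiderivatives of `φ''` and `|ξ| ≤ r`, the bound on the inverse operator
controls the whole energy. -/
theorem energy_le_of_small {r K : ℝ} (hK0 : 0 ≤ K)
    (hK : ∀ w : L2, ‖w‖ ≤ K * ‖bvp A B C ξ w‖) (hξ : |ξ| ≤ r) {φ : H 3}
    (hφ : IsSolution A B C ξ h φ) :
    energy ξ φ ≤ (1 + 2 * r ^ 2 * ‖anti‖ ^ 2 + r ^ 4 * (‖anti‖ * ‖anti‖) ^ 2) *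
      (K * (‖proj‖ * (‖anti‖ * ‖liftOne‖))) ^ 2 * ‖h‖ ^ 2 := by
  obtain ⟨f, hfn, hf⟩ := exists_bil_eq h
  obtain ⟨-, e1, e0, -⟩ := (isSolution_iff hf φ).1 hφ
  have hw : ‖φ.1 2‖ ≤ K * (‖proj‖ * (‖anti‖ * ‖liftOne‖)) * ‖h‖ := by
    refine (hK _).trans ?_
    rw [bvp_eq_of_isSolution hf hφ, mul_assoc, mul_assoc, mul_assoc]
    gcongr
    refine (proj.le_opNorm _).trans ?_
    gcongr
    rw [norm_neg]
    refine (anti.le_opNorm _).trans ?_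
    gcongr
  have h1 : ‖φ.1 1‖ ≤ ‖anti‖ * ‖φ.1 2‖ := e1 ▸ anti.le_opNorm _
  have h0 : ‖φ.1 0‖ ≤ ‖anti‖ * ‖anti‖ * ‖φ.1 2‖ := by
    rw [e0, mul_assoc]
    refine (anti.le_opNorm _).trans ?_
    gcongr
    exact anti.le_opNorm _
  have x2 : ξ ^ 2 ≤ r ^ 2 := by rw [← sq_abs ξ]; gcongr
  have x4 : ξ ^ 4 ≤ r ^ 4 := by
    rw [← Even.pow_abs (by decide : Even 4) ξ]; gcongr
  calc energy ξ φ ≤ ‖φ.1 2‖ ^ 2 + 2 * r ^ 2 * (‖anti‖ * ‖φ.1 2‖) ^ 2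
        + r ^ 4 * (‖anti‖ * ‖anti‖ * ‖φ.1 2‖) ^ 2 := by
        rw [energy_eq]; gcongr
    _ = (1 + 2 * r ^ 2 * ‖anti‖ ^ 2 + r ^ 4 * (‖anti‖ * ‖anti‖) ^ 2) * ‖φ.1 2‖ ^ 2 := by ring
    _ ≤ (1 + 2 * r ^ 2 * ‖anti‖ ^ 2 + r ^ 4 * (‖anti‖ * ‖anti‖) ^ 2) *
          (K * (‖proj‖ * (‖anti‖ * ‖liftOne‖)) * ‖h‖) ^ 2 := by gcongr
    _ = _ := by ring

theorem le_of_sq_le_mul {E b : ℝ} (hb : 0 ≤ b) (h : E ^ 2 ≤ b * E) : E ≤ b := by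
  by_contra hlt
  nlinarith [not_le.1 hlt]

theorem energy_nonneg (φ : H 3) : 0 ≤ energy ξ φ := by
  rw [energy_eq]
  positivity

/-- For `|ξ| ≥ 1` the energy dominates `‖v‖²`, so one factor of the energy cancels from `E² ≤
4‖h‖²‖v‖²`. -/
theorem energy_le_dual {v : H0 1} {φ : H 3} (hξ : 1 ≤ |ξ|)
    (hv : ‖v‖ ^ 2 = ‖φ.1 0‖ ^ 2 + ‖φ.1 1‖ ^ 2) (he : energy ξ φ ≤ 2 * ‖h v‖) :
    energy ξ φ ≤ 4 * ‖h‖ ^ 2 := by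
  have x2 : 1 ≤ ξ ^ 2 := by rw [← sq_abs]; exact one_le_pow₀ hξ
  have x4 : 1 ≤ ξ ^ 4 := by nlinarith
  have hvE : ‖v‖ ^ 2 ≤ energy ξ φ := by
    rw [hv, energy_eq]
    nlinarith [sq_nonneg ‖φ.1 0‖, sq_nonneg ‖φ.1 1‖, sq_nonneg ‖φ.1 2‖]
  refine le_of_sq_le_mul (by positivity) ?_
  calc energy ξ φ ^ 2 ≤ (2 * (‖h‖ * ‖v‖)) ^ 2 := by
        have := energy_nonneg (ξ := ξ) φ
        gcongr
        exact he.trans (by gcongr; exact norm_HNegOne_apply_le h v)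
    _ = 4 * ‖h‖ ^ 2 * ‖v‖ ^ 2 := by ring
    _ ≤ _ := by gcongr

/-- The pairing with `g` needs only `‖φ‖`, and `ξ²‖φ‖² ≤ E`; this is where the factor `ξ⁻²` is
gained. -/
theorem energy_le_L2 {v : H0 1} {φ : H 3} {g : L2} (hg : IsGivenBy h g) (hξ : 1 ≤ |ξ|)
    (hv : v.1.1 0 = star (φ.1 0)) (he : energy ξ φ ≤ 2 * ‖h v‖) :
    energy ξ φ ≤ 4 * (ξ⁻¹ ^ 2 * ‖g‖ ^ 2) := by
  have x2 : 1 ≤ ξ ^ 2 := by rw [← sq_abs]; exact one_le_pow₀ hξ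
  have x0 : ξ ≠ 0 := by rintro rfl; norm_num at x2
  have hφE : ξ ^ 2 * ‖φ.1 0‖ ^ 2 ≤ energy ξ φ := by
    rw [energy_eq]
    have : ξ ^ 2 * ‖φ.1 0‖ ^ 2 ≤ ξ ^ 4 * ‖φ.1 0‖ ^ 2 := by
      gcongr ?_ * _
      nlinarith
    have : 0 ≤ 2 * ξ ^ 2 * ‖φ.1 1‖ ^ 2 := by positivity
    nlinarith [sq_nonneg ‖φ.1 2‖]
  refine le_of_sq_le_mul (by positivity) ?_
  calc energy ξ φ ^ 2 ≤ (2 * (‖g‖ * ‖φ.1 0‖)) ^ 2 := by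
        have := energy_nonneg (ξ := ξ) φ
        gcongr
        refine he.trans ?_
        gcongr
        rw [hg v]
        refine (norm_bil_le g (v.1.1 0)).trans (le_of_eq ?_)
        rw [hv, norm_star_L2]
    _ = 4 * (ξ⁻¹ ^ 2 * ‖g‖ ^ 2) * (ξ ^ 2 * ‖φ.1 0‖ ^ 2) := by field_simp; ring
    _ ≤ _ := by gcongr

end

/-! ### The uniform bound and the main theorem -/

theorem exists_energy_bound {A B C : ℝ} (hABC : Admissible A B C) :
    ∃ c : ℝ, 0 < c ∧ ∀ ξ : ℝ, ξ ≠ 0 → ∀ h : HNegOne, ∀ φ : H 3, IsSolution A B C ξ h φ →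
      energy ξ φ ≤ c * ‖h‖ ^ 2 ∧
      ∀ g : L2, IsGivenBy h g → energy ξ φ ≤ c * (ξ⁻¹ ^ 2 * ‖g‖ ^ 2) := by
  set M := mulOp (profile A B C) (continuous_profile A B C)
  -- The threshold: `r ≥ ‖M‖` for the absorption at large `|ξ|`, `r ≥ 1` for comparing powers of
  -- `ξ`.
  obtain ⟨r, hr1, hrM⟩ : ∃ r : ℝ, 1 ≤ r ∧ ‖M‖ ≤ r := ⟨max 1 ‖M‖, le_max_left _ _, le_max_right _ _⟩
  obtain ⟨K, hK0, hK⟩ := exists_bound_bvp hABC r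
  set d := (1 + 2 * r ^ 2 * ‖anti‖ ^ 2 + r ^ 4 * (‖anti‖ * ‖anti‖) ^ 2) *
      (K * (‖proj‖ * (‖anti‖ * ‖liftOne‖))) ^ 2
  have hd : 0 ≤ d := by positivity
  -- `4` serves `|ξ| ≥ r`. For `|ξ| ≤ r` the factor is `d`, and the `L²` bound costs a further `r²`
  -- through `1 ≤ r²ξ⁻²`.
  refine ⟨4 + d * r ^ 2, by positivity, fun ξ hξ h φ hφ => ?_⟩
  have hdr : d ≤ d * r ^ 2 := le_mul_of_one_le_right hd (one_le_pow₀ hr1)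
  rcases le_total |ξ| r with hle | hle
  · have h1 : energy ξ φ ≤ d * ‖h‖ ^ 2 :=
      energy_le_of_small hK0 (hK ξ (abs_le.1 hle)) hle hφ
    refine ⟨h1.trans ?_, fun g hg => h1.trans ?_⟩
    · gcongr
      linarith
    · have h2 := hg.norm_le
      have h3 : 1 ≤ r ^ 2 * ξ⁻¹ ^ 2 := by
        rw [← mul_pow, ← sq_abs, abs_mul, abs_inv, abs_of_pos (by linarith : 0 < r)]
        refine one_le_pow₀ ?_
        rw [← div_eq_mul_inv]
        exact (one_le_div (abs_pos.2 hξ)).2 hle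
      calc d * ‖h‖ ^ 2 ≤ d * ‖g‖ ^ 2 := by gcongr
        _ ≤ d * ((r ^ 2 * ξ⁻¹ ^ 2) * ‖g‖ ^ 2) := by
          gcongr
          exact le_mul_of_one_le_left (by positivity) h3
        _ = d * r ^ 2 * (ξ⁻¹ ^ 2 * ‖g‖ ^ 2) := by ring
        _ ≤ _ := by
          gcongr
          linarith
  · obtain ⟨v, hv0, hvn, hv⟩ := energy_le_of_large hrM hle hφ
    have h1 := hr1.trans hle
    have h4 : (4 : ℝ) ≤ 4 + d * r ^ 2 := le_add_of_nonneg_right (by positivity)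
    refine ⟨(energy_le_dual h1 hvn hv).trans (by gcongr), fun g hg => ?_⟩
    exact (energy_le_L2 hg h1 hv0 hv).trans (by gcongr)

end OrrSommerfeld

theorem mainTheorem9 (A B C : ℝ) (hABC : OrrSommerfeld.Admissible A B C) :
    ∃ c : ℝ, 0 < c ∧ ∀ ξ : ℝ, ξ ≠ 0 → ∀ h : OrrSommerfeld.HNegOne,
      (∃! φ : OrrSommerfeld.H 3, OrrSommerfeld.IsSolution A B C ξ h φ) ∧
      ∀ φ : OrrSommerfeld.H 3, OrrSommerfeld.IsSolution A B C ξ h φ →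
        OrrSommerfeld.energy ξ φ ≤ c * ‖h‖ ^ 2 ∧
        ∀ g : OrrSommerfeld.L2, OrrSommerfeld.IsGivenBy h g →
          OrrSommerfeld.energy ξ φ ≤ c * min (‖h‖ ^ 2) (ξ⁻¹ ^ 2 * ‖g‖ ^ 2) := by
  obtain ⟨c, hc, hb⟩ := OrrSommerfeld.exists_energy_bound hABC
  refine ⟨c, hc, fun ξ hξ h => ⟨OrrSommerfeld.existsUnique_isSolution hABC, fun φ hφ => ?_⟩⟩
  obtain ⟨h1, h2⟩ := hb ξ hξ h φ hφ
  refine ⟨h1, fun g hg => ?_⟩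
  rw [mul_min_of_nonneg _ _ hc.le]
  exact le_min h1 (h2 g hg)
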